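/- Let $\omega,\alpha,\beta\in\mathbb R$ with $\omega-|\alpha+\beta|>0$. In $L^2(\mathbb R)$ (inner product antilinear in the first argument) let $a=\frac{d}{dx}+x$ and $a^*=-\frac{d}{dx}+x$ on $\mathrm{Dom}(a)=\{\psi\in W^{1,2}(\mathbb R): x\psi\in L^2(\mathbb R)\}$, and let $$t[\psi]=(\omega-\alpha-\beta)\|\psi'\|^2+(\omega+\alpha+\beta)\|x\psi\|^2+(\alpha-\beta)\bigl(\langle x\psi,\psi'\rangle-\langle\psi',x\psi\rangle\bigr),\qquad \mathrm{Dom}(t)=\mathrm{Dom}(a).$$ Then $t$ is densely defined, sectorial and closed; the operator $H$ associated with $t$ by the first representation theorem (that is, $\psi\in\mathrm{Dom}(H)$ and $H\psi=\eta$ iff $\psi\in \mathrm{Dom}(t)$ and $t(\varphi,\psi)=\langle\varphi,\eta\rangle$ for all $\varphi\in\mathrm{Dom}(t)$) is m-sectorial, and $H$ extends the operator $\omega\,a^*a+\alpha\,a^2+\beta\,(a^*)^2+\omega$ taken on its natural domain. Put $\delta=(\omega+\alpha+\beta)^{1/2}(\omega-\alpha-\beta)^{-1/2}$ and $\zeta=\sqrt{\omega^2-(\alpha+\beta)^2}+i(\alpha-\beta)$,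 and let $\mathcal U=\mathcal U_1\mathcal U_2\mathcal U_3$ be the unitary operator on $L^2(\mathbb R)$ given by $$(\mathcal U_1\psi)(x)=e^{-i\delta x^2/2}\psi(x),\qquad \mathcal U_2=\mathcal F^{-1}e^{-i\xi^2/(4\delta)}\mathcal F,\qquad (\mathcal U_3\psi)(x)=(2\delta)^{1/4}\psi\bigl((2\delta)^{1/2}x\bigr),$$ where $\mathcal F$ is the unitary Fourier transform $(\mathcal Fu)(\xi)=(2\pi)^{-1/2}\int_{\mathbb R}e^{-ix\xi}u(x)\,dx$. Then, as an equality of unbounded operators including their domains, $$\mathcal U^*H\,\mathcal U=\zeta\Bigl(-\frac{d^2}{dx^2}+\frac{\overline\zeta}{\zeta}\,x^2\Bigr),$$ where $-\frac{d^2}{dx^2}+c\,x^2$ denotes the operator associated, in the same way, with the form $\langle\varphi',\psi'\rangle+c\,\langle x\varphi,x\psi\rangle$ on $\mathrm{Dom}(a)$; moreover $\mathcal U^*H\,\mathcal U$ extends the differential expression on the right taken on its natural domain $\{\psi:\psi',\psi'',x\psi,x^2\psi\in L^2(\mathbb R)\}$. This operator is a positive multiple of a rotated harmonic oscillator: with $\theta=-\arg\zeta$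 one has $|\theta|<\pi/2$ and $\mathcal U^*H\,\mathcal U=|\zeta|\,H_\theta$, where $H_\theta=-e^{-i\theta}\frac{d^2}{dx^2}+e^{i\theta}x^2$ is the m-sectorial operator associated with the sectorial closed form $e^{-i\theta}\langle\varphi',\psi'\rangle+e^{i\theta}\langle x\varphi,x\psi\rangle$ on $\mathrm{Dom}(a)$. -/

import Mathlib

open MeasureTheory
open scoped InnerProductSpace SchwartzMap FourierTransform

namespace Swanson

noncomputable section

/-! ### Unbounded operators and sesquilinear forms in a complex Hilbert space -/

/-- A sesquilinear form (antilinear in the first argument) defined on a linear subspace of `E`. -/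
structure SesqForm (E : Type*) [NormedAddCommGroup E] [InnerProductSpace ℂ E] where
  /-- the form domain -/
  domain : Submodule ℂ E
  /-- the values `t(φ, ψ)` of the form -/
  toFun : domain →ₗ⋆[ℂ] domain →ₗ[ℂ] ℂ

section Abstract

variable {E : Type*} [NormedAddCommGroup E] [InnerProductSpace ℂ E]

/-- The form is sectorial: its numerical range lies in a sector
`{z | |Im z| ≤ k (Re z - γ), Re z ≥ γ}`. -/
def SesqForm.IsSectorial (t : SesqForm E) : Prop :=
  ∃ γ k : ℝ, ∀ ψ : t.domain,
    γ * ‖(ψ : E)‖ ^ 2 ≤ (t.toFun ψ ψ).re ∧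
    |(t.toFun ψ ψ).im| ≤ k * ((t.toFun ψ ψ).re - γ * ‖(ψ : E)‖ ^ 2)

/-- The form is closed: if `ψₙ` lies in the form domain, `ψₙ → ψ` in `E` and `t[ψₙ - ψₘ] → 0`,
then `ψ` lies in the form domain and `t[ψₙ - ψ] → 0`. -/
def SesqForm.IsClosed (t : SesqForm E) : Prop :=
  ∀ (u : ℕ → t.domain) (ψ : E),
    Filter.Tendsto (fun n => (u n : E)) Filter.atTop (nhds ψ) →
    Filter.Tendsto (fun p : ℕ × ℕ => t.toFun (u p.1 - u p.2) (u p.1 - u p.2))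
      Filter.atTop (nhds 0) →
    ∃ h : ψ ∈ t.domain,
      Filter.Tendsto (fun n => t.toFun (u n - ⟨ψ, h⟩) (u n - ⟨ψ, h⟩)) Filter.atTop (nhds 0)

/-- The graph of the operator associated with a form: the pairs `(ψ, η)` with `ψ` in the form
domain and `t(φ, ψ) = ⟪φ, η⟫` for all `φ` in the form domain. -/
def SesqForm.operatorGraph (t : SesqForm E) : Submodule ℂ (E × E) where
  carrier := {p | ∃ h : p.1 ∈ t.domain, ∀ φ : t.domain, t.toFun φ ⟨p.1, h⟩ = ⟪(φ : E), p.2⟫_ℂ}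
  zero_mem' := ⟨t.domain.zero_mem, fun φ => by
    have : (⟨(0 : E × E).1, t.domain.zero_mem⟩ : t.domain) = 0 := rfl
    rw [this]; simp⟩
  add_mem' := by
    rintro p q ⟨hp, hp'⟩ ⟨hq, hq'⟩
    refine ⟨t.domain.add_mem hp hq, fun φ => ?_⟩
    have : (⟨(p + q).1, t.domain.add_mem hp hq⟩ : t.domain) = ⟨p.1, hp⟩ + ⟨q.1, hq⟩ := rfl
    rw [this, map_add, hp', hq', Prod.snd_add, inner_add_right]
  smul_mem' := by
    rintro c p ⟨hp, hp'⟩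
    refine ⟨t.domain.smul_mem c hp, fun φ => ?_⟩
    have : (⟨(c • p).1, t.domain.smul_mem c hp⟩ : t.domain) = c • ⟨p.1, hp⟩ := rfl
    rw [this, map_smul, hp', Prod.smul_snd, inner_smul_right, smul_eq_mul]

/-- The operator associated with a densely defined form (first representation theorem):
`ψ` belongs to its domain and is mapped to `η` iff `ψ` is in the form domain and
`t(φ, ψ) = ⟪φ, η⟫` for all `φ` in the form domain. -/
def SesqForm.operator (t : SesqForm E) : E →ₗ.[ℂ] E := t.operatorGraph.toLinearPMap

theorem SesqForm.operator_graph (t : SesqForm E) (ht : Dense (t.domain : Set E)) :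
    t.operator.graph = t.operatorGraph := by
  refine Submodule.toLinearPMap_graph_eq _ ?_
  rintro ⟨ψ, η⟩ ⟨h, h'⟩ (rfl : ψ = 0)
  have h0 : ∀ φ ∈ (t.domain : Set E), ⟪φ, η⟫_ℂ = 0 := fun φ hφ => by
    rw [← h' ⟨φ, hφ⟩]
    have : (⟨((0 : E), η).1, h⟩ : t.domain) = 0 := rfl
    rw [this, map_zero]
  exact ht.eq_zero_of_inner_left (𝕜 := ℂ) fun φ hφ => inner_eq_zero_symm.1 (h0 φ hφ)

/-- An operator is m-sectorial: densely defined, its numerical range lies in a sector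
`{z | |Im z| ≤ k (Re z - γ), Re z ≥ γ}`, and `T - z` is onto whenever `Re z < γ`. -/
def IsMSectorial (T : E →ₗ.[ℂ] E) : Prop :=
  Dense (T.domain : Set E) ∧ ∃ γ k : ℝ,
    (∀ ψ : T.domain,
      γ * ‖(ψ : E)‖ ^ 2 ≤ (⟪(ψ : E), T ψ⟫_ℂ).re ∧
      |(⟪(ψ : E), T ψ⟫_ℂ).im| ≤ k * ((⟪(ψ : E), T ψ⟫_ℂ).re - γ * ‖(ψ : E)‖ ^ 2)) ∧
    ∀ z : ℂ, z.re < γ → Function.Surjective fun ψ : T.domain => T ψ - z • (ψ : E)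

/-- The product `S T` of two unbounded operators, with its natural domain
`{ψ ∈ Dom T | T ψ ∈ Dom S}`. -/
def opComp (S T : E →ₗ.[ℂ] E) : E →ₗ.[ℂ] E where
  domain := (S.domain.comap T.toFun).map T.domain.subtype
  toFun :=
    { toFun := fun ψ => S ⟨T ⟨ψ, by
          obtain ⟨x, _, hx⟩ := ψ.2; rw [← hx]; exact x.2⟩, by
          obtain ⟨_, x, hx, rfl⟩ := ψ; exact hx⟩
      map_add' := fun x y => by
        rw [← LinearPMap.map_add]
        congr 1
        exact Subtype.ext (LinearPMap.map_add T ⟨x, _⟩ ⟨y, _⟩)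
      map_smul' := fun c x => by
        rw [RingHom.id_apply, ← LinearPMap.map_smul]
        congr 1
        exact Subtype.ext (LinearPMap.map_smul T c ⟨x, _⟩) }

/-- The identity operator on all of `E`. -/
def opId : E →ₗ.[ℂ] E := LinearMap.id.toPMap ⊤

/-- `U* T U` for a unitary `U`, with its natural domain `{ψ | U ψ ∈ Dom T}`. -/
def unitaryConj (U : E ≃ₗᵢ[ℂ] E) (T : E →ₗ.[ℂ] E) : E →ₗ.[ℂ] E where
  domain := T.domain.comap (U.toLinearEquiv : E →ₗ[ℂ] E)
  toFun :=
    { toFun := fun ψ => U.symm (T ⟨U ψ, ψ.2⟩)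
      map_add' := fun x y => by
        rw [← map_add, ← LinearPMap.map_add]
        congr 2
        ext1
        exact map_add U _ _
      map_smul' := fun c x => by
        rw [RingHom.id_apply, ← map_smul, ← LinearPMap.map_smul]
        congr 2
        ext1
        exact map_smul U c _ }

end Abstract

/-! ### Position, derivative, creation and annihilation operators in `L²(ℝ)` -/

/-- The complex Hilbert space `L²(ℝ)`. -/
abbrev L2 : Type := Lp ℂ 2 (volume : Measure ℝ)

/-- Pairs `(ψ, η)` of `L²` functions such that `η` is the derivative of `ψ` in
the sense of (tempered) distributions, that is, its weak derivative. -/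
def derivGraph : Submodule ℂ (L2 × L2) where
  carrier := {p | TemperedDistribution.derivCLM ℂ (Lp.toTemperedDistributionCLM ℂ volume 2 p.1) =
    Lp.toTemperedDistributionCLM ℂ volume 2 p.2}
  zero_mem' := by
    change TemperedDistribution.derivCLM ℂ (Lp.toTemperedDistributionCLM ℂ volume 2 0) =
      Lp.toTemperedDistributionCLM ℂ volume 2 0
    rw [map_zero, map_zero]
  add_mem' := by
    intro p q hp hq
    simp only [Set.mem_ofPred_eq, Prod.fst_add, Prod.snd_add, map_add] at hp hq ⊢
    rw [hp, hq]
  smul_mem' := by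
    intro c p hp
    simp only [Set.mem_ofPred_eq, Prod.smul_fst, Prod.smul_snd, map_smul] at hp ⊢
    rw [hp]

/-- Pairs `(ψ, η)` of `L²` functions such that `η(x) = x ψ(x)` for almost every `x`. -/
def positionGraph : Submodule ℂ (L2 × L2) where
  carrier := {p | ∀ᵐ x : ℝ, p.2 x = (x : ℂ) * p.1 x}
  zero_mem' := by
    change ∀ᵐ x : ℝ, (0 : L2) x = (x : ℂ) * (0 : L2) x
    filter_upwards [Lp.coeFn_zero ℂ 2 (volume : Measure ℝ)] with x hx
    simp
  add_mem' := by
    intro p q hp hq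
    filter_upwards [hp, hq, Lp.coeFn_add p.1 q.1, Lp.coeFn_add p.2 q.2] with x h1 h2 h3 h4
    simp only [Prod.fst_add, Prod.snd_add, h3, h4, Pi.add_apply, h1, h2]
    ring
  smul_mem' := by
    intro c p hp
    filter_upwards [hp, Lp.coeFn_smul c p.1, Lp.coeFn_smul c p.2] with x h1 h3 h4
    simp only [Prod.smul_fst, Prod.smul_snd, h3, h4, Pi.smul_apply, h1, smul_eq_mul]
    ring

/-- The operator `d/dx` in `L²(ℝ)` with domain `W^{1,2}(ℝ)`. -/
def ddx : L2 →ₗ.[ℂ] L2 := derivGraph.toLinearPMap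

/-- The operator of multiplication by `x` with its maximal domain `{ψ ∈ L² | x ψ ∈ L²}`. -/
def position : L2 →ₗ.[ℂ] L2 := positionGraph.toLinearPMap

theorem ddx_graph : ddx.graph = derivGraph := by
  refine Submodule.toLinearPMap_graph_eq _ ?_
  rintro ⟨ψ, η⟩ h (rfl : ψ = 0)
  have h' : Lp.toTemperedDistributionCLM ℂ volume 2 η = 0 := by
    have h2 : TemperedDistribution.derivCLM ℂ (Lp.toTemperedDistributionCLM ℂ volume 2 (0 : L2)) =
      Lp.toTemperedDistributionCLM ℂ volume 2 η := h
    rw [← h2, map_zero, map_zero]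
  have := Lp.ker_toTemperedDistributionCLM_eq_bot (F := ℂ) (μ := (volume : Measure ℝ)) (p := 2)
  exact (Submodule.eq_bot_iff _).1 this η h'

theorem position_graph : position.graph = positionGraph := by
  refine Submodule.toLinearPMap_graph_eq _ ?_
  rintro ⟨ψ, η⟩ h (rfl : ψ = 0)
  refine Lp.ext ?_
  have h1 : ∀ᵐ x : ℝ, η x = (x : ℂ) * (0 : L2) x := h
  filter_upwards [h1] with x hx
  simp [hx]

/-- The annihilation operator `a = d/dx + x` on `W^{1,2}(ℝ) ∩ L²(ℝ, x² dx)`. -/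
def annihilation : L2 →ₗ.[ℂ] L2 := ddx + position

/-- The creation operator `a* = -d/dx + x` on `W^{1,2}(ℝ) ∩ L²(ℝ, x² dx)`. -/
def creation : L2 →ₗ.[ℂ] L2 := -ddx + position

/-- The form domain `Dom(a) = {ψ ∈ W^{1,2}(ℝ) | x ψ ∈ L²(ℝ)}`. -/
def formDomain : Submodule ℂ L2 := ddx.domain ⊓ position.domain

/-- `ψ ↦ ψ'` on the form domain. -/
def formDeriv : formDomain →ₗ[ℂ] L2 :=
  ddx.toFun.comp (Submodule.inclusion inf_le_left)

/-- `ψ ↦ x ψ` on the form domain. -/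
def formPosition : formDomain →ₗ[ℂ] L2 :=
  position.toFun.comp (Submodule.inclusion inf_le_right)

/-- The sesquilinear form `(φ, ψ) ↦ ⟪A φ, B ψ⟫` for linear maps `A`, `B` on the form domain. -/
def innerForm (A B : formDomain →ₗ[ℂ] L2) : formDomain →ₗ⋆[ℂ] formDomain →ₗ[ℂ] ℂ :=
  LinearMap.mk₂'ₛₗ (starRingEnd ℂ) (RingHom.id ℂ) (fun φ ψ => ⟪A φ, B ψ⟫_ℂ)
    (fun φ₁ φ₂ ψ => by rw [map_add, inner_add_left])
    (fun c φ ψ => by rw [map_smul, inner_smul_left, smul_eq_mul])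
    (fun φ ψ₁ ψ₂ => by rw [map_add, inner_add_right])
    (fun c φ ψ => by rw [map_smul, inner_smul_right, RingHom.id_apply, smul_eq_mul])

/-! ### The operators -/

/-- The quadratic form of Swanson's model,
`t[ψ] = (ω-α-β)‖ψ'‖² + (ω+α+β)‖xψ‖² + (α-β)(⟪xψ, ψ'⟫ - ⟪ψ', xψ⟫)`, on `Dom(a)`. -/
def swansonForm (ω α β : ℝ) : SesqForm L2 where
  domain := formDomain
  toFun := ((ω - α - β : ℝ) : ℂ) • innerForm formDeriv formDeriv
    + ((ω + α + β : ℝ) : ℂ) • innerForm formPosition formPosition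
    + ((α - β : ℝ) : ℂ) • (innerForm formPosition formDeriv - innerForm formDeriv formPosition)

/-- Swanson's operator: the m-sectorial operator associated with `swansonForm`. -/
def swanson (ω α β : ℝ) : L2 →ₗ.[ℂ] L2 := (swansonForm ω α β).operator

/-- The expression `ω a*a + α a² + β (a*)² + ω` on its natural operator domain. -/
def ladderExpression (ω α β : ℝ) : L2 →ₗ.[ℂ] L2 :=
  (ω : ℂ) • opComp creation annihilation + (α : ℂ) • opComp annihilation annihilation
    + (β : ℂ) • opComp creation creation + (ω : ℂ) • opId

/-- The form `c₁ ⟪φ', ψ'⟫ + c₂ ⟪xφ, xψ⟫` on `Dom(a)`. -/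
def oscillatorForm (c₁ c₂ : ℂ) : SesqForm L2 where
  domain := formDomain
  toFun := c₁ • innerForm formDeriv formDeriv + c₂ • innerForm formPosition formPosition

/-- The oscillator `-c₁ d²/dx² + c₂ x²`, as the operator associated with `oscillatorForm c₁ c₂`. -/
def oscillator (c₁ c₂ : ℂ) : L2 →ₗ.[ℂ] L2 := (oscillatorForm c₁ c₂).operator

/-- The sectorial form `e^{-iθ} ⟪φ', ψ'⟫ + e^{iθ} ⟪xφ, xψ⟫` of the rotated oscillator. -/
def rotatedForm (θ : ℝ) : SesqForm L2 :=
  oscillatorForm (Complex.exp (-Complex.I * θ)) (Complex.exp (Complex.I * θ))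

/-- The rotated harmonic oscillator `-e^{-iθ} d²/dx² + e^{iθ} x²`, for `|θ| < π/2`. -/
def rotatedOscillator (θ : ℝ) : L2 →ₗ.[ℂ] L2 := (rotatedForm θ).operator

/-! ### The unitary operators -/

theorem memLp_phase {g : ℝ → ℝ} (hg : Measurable g) (ψ : L2) :
    MemLp (fun x => Complex.exp (Complex.I * g x) * ψ x) 2 volume := by
  refine (Lp.memLp ψ).of_le ?_ ?_
  · exact (by fun_prop : Measurable fun x => Complex.exp (Complex.I * g x)).aestronglyMeasurable.mul
      (Lp.aestronglyMeasurable ψ)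
  · refine Filter.Eventually.of_forall fun x => ?_
    rw [norm_mul, mul_comm Complex.I, Complex.norm_exp_ofReal_mul_I, one_mul]

/-- Multiplication by the unimodular function `e^{i g}`, as a linear map. -/
def phaseMap (g : ℝ → ℝ) (hg : Measurable g) : L2 →ₗ[ℂ] L2 where
  toFun ψ := (memLp_phase hg ψ).toLp
  map_add' φ ψ := by
    rw [← MemLp.toLp_add, MemLp.toLp_eq_toLp_iff]
    filter_upwards [Lp.coeFn_add φ ψ] with x hx
    rw [hx, Pi.add_apply, mul_add]
    rfl
  map_smul' c ψ := by
    rw [RingHom.id_apply, ← MemLp.toLp_const_smul, MemLp.toLp_eq_toLp_iff]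
    filter_upwards [Lp.coeFn_smul c ψ] with x hx
    simp only [hx, Pi.smul_apply, smul_eq_mul]
    ring

theorem phaseMap_phaseMap {g h : ℝ → ℝ} (hg : Measurable g) (hh : Measurable h)
    (hgh : ∀ x, g x + h x = 0) (ψ : L2) : phaseMap g hg (phaseMap h hh ψ) = ψ := by
  refine Lp.ext ?_
  filter_upwards [(memLp_phase hg (phaseMap h hh ψ)).coeFn_toLp,
    (memLp_phase hh ψ).coeFn_toLp] with x h1 h2
  have h3 : phaseMap h hh ψ x = Complex.exp (Complex.I * h x) * ψ x := h2
  have h4 : phaseMap g hg (phaseMap h hh ψ) x =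
    Complex.exp (Complex.I * g x) * phaseMap h hh ψ x := h1
  rw [h4, h3, ← mul_assoc, ← Complex.exp_add, ← mul_add, ← Complex.ofReal_add, hgh]
  simp

/-- The unitary operator of multiplication by the unimodular function `e^{i g}`. -/
def phase (g : ℝ → ℝ) (hg : Measurable g) : L2 ≃ₗᵢ[ℂ] L2 where
  toLinearEquiv := LinearEquiv.ofLinearMap (phaseMap g hg) (phaseMap (fun x => -g x) hg.neg)
    (LinearMap.ext fun ψ => phaseMap_phaseMap hg hg.neg (fun x => by simp) ψ)
    (LinearMap.ext fun ψ => phaseMap_phaseMap hg.neg hg (fun x => by simp) ψ)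
  norm_map' ψ := by
    change ‖(memLp_phase hg ψ).toLp‖ = ‖ψ‖
    rw [Lp.norm_toLp, Lp.norm_def]
    congr 1
    refine eLpNorm_congr_norm_ae (Filter.Eventually.of_forall fun x => ?_)
    rw [norm_mul, mul_comm Complex.I, Complex.norm_exp_ofReal_mul_I, one_mul]

theorem phase_apply {g : ℝ → ℝ} (hg : Measurable g) (ψ : L2) :
    ∀ᵐ x : ℝ, phase g hg ψ x = Complex.exp (Complex.I * g x) * ψ x :=
  (memLp_phase hg ψ).coeFn_toLp

theorem aestronglyMeasurable_dilation {c : ℝ} (hc : 0 < c) (ψ : L2) :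
    AEStronglyMeasurable (fun x => ψ (c * x)) volume := by
  have hq : Measure.QuasiMeasurePreserving (fun x : ℝ => c * x) volume volume := by
    refine ⟨by fun_prop, ?_⟩
    rw [Real.map_volume_mul_left hc.ne']
    exact Measure.smul_absolutelyContinuous
  exact (Lp.aestronglyMeasurable ψ).comp_quasiMeasurePreserving hq

theorem eLpNorm_dilation {c : ℝ} (hc : 0 < c) (ψ : L2) :
    eLpNorm (fun x => (Real.sqrt c : ℂ) * ψ (c * x)) 2 volume = eLpNorm ψ 2 volume := by
  have h1 : eLpNorm (fun x => ψ (c * x)) 2 volume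
      = eLpNorm ψ 2 (Measure.map (fun x : ℝ => c * x) volume) := by
    rw [eLpNorm_map_measure _ (by fun_prop)]
    · rfl
    · rw [Real.map_volume_mul_left hc.ne']
      exact (Lp.aestronglyMeasurable ψ).smul_measure _
  have h2 : eLpNorm (fun x => (Real.sqrt c : ℂ) * ψ (c * x)) 2 volume
      = ‖(Real.sqrt c : ℂ)‖ₑ * eLpNorm (fun x => ψ (c * x)) 2 volume :=
    eLpNorm_const_smul (Real.sqrt c : ℂ) (fun x => ψ (c * x)) 2 volume
  rw [h2, h1, Real.map_volume_mul_left hc.ne',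
    eLpNorm_smul_measure_of_ne_top (by simp), smul_eq_mul, ← mul_assoc]
  convert one_mul _
  rw [abs_of_pos (inv_pos.2 hc), ENNReal.ofReal_rpow_of_pos (inv_pos.2 hc),
    ← ofReal_norm, ← ENNReal.ofReal_mul (norm_nonneg _)]
  have h3 : ‖(Real.sqrt c : ℂ)‖ = Real.sqrt c := by
    rw [Complex.norm_real, Real.norm_of_nonneg (Real.sqrt_nonneg c)]
  have h4 : (c⁻¹ : ℝ) ^ (1 / (2 : ENNReal)).toReal = (Real.sqrt c)⁻¹ := by
    rw [← Real.sqrt_inv, Real.sqrt_eq_rpow]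
    simp
  rw [h3, h4, mul_inv_cancel₀ (Real.sqrt_pos.2 hc).ne', ENNReal.ofReal_one]

theorem memLp_dilation {c : ℝ} (hc : 0 < c) (ψ : L2) :
    MemLp (fun x => (Real.sqrt c : ℂ) * ψ (c * x)) 2 volume :=
  ⟨(aestronglyMeasurable_dilation hc ψ).const_mul _, by
    rw [eLpNorm_dilation hc]; exact Lp.eLpNorm_lt_top ψ⟩

theorem ae_comp_mul {c : ℝ} (hc : 0 < c) {p : ℝ → Prop} (h : ∀ᵐ x : ℝ, p x) :
    ∀ᵐ x : ℝ, p (c * x) := by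
  have hq : Measure.QuasiMeasurePreserving (fun x : ℝ => c * x) volume volume := by
    refine ⟨by fun_prop, ?_⟩
    rw [Real.map_volume_mul_left hc.ne']
    exact Measure.smul_absolutelyContinuous
  exact hq.ae h

/-- The dilation `ψ ↦ c^{1/2} ψ(c x)`, as a linear map. -/
def dilationMap (c : ℝ) (hc : 0 < c) : L2 →ₗ[ℂ] L2 where
  toFun ψ := (memLp_dilation hc ψ).toLp
  map_add' φ ψ := by
    rw [← MemLp.toLp_add, MemLp.toLp_eq_toLp_iff]
    filter_upwards [ae_comp_mul hc (Lp.coeFn_add φ ψ)] with x hx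
    rw [hx, Pi.add_apply, mul_add]
    rfl
  map_smul' a ψ := by
    rw [RingHom.id_apply, ← MemLp.toLp_const_smul, MemLp.toLp_eq_toLp_iff]
    filter_upwards [ae_comp_mul hc (Lp.coeFn_smul a ψ)] with x hx
    simp only [hx, Pi.smul_apply, smul_eq_mul]
    ring

theorem dilationMap_dilationMap {c d : ℝ} (hc : 0 < c) (hd : 0 < d) (hcd : c * d = 1) (ψ : L2) :
    dilationMap c hc (dilationMap d hd ψ) = ψ := by
  refine Lp.ext ?_
  filter_upwards [(memLp_dilation hc (dilationMap d hd ψ)).coeFn_toLp,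
    ae_comp_mul hc (memLp_dilation hd ψ).coeFn_toLp] with x h1 h2
  have h3 : dilationMap d hd ψ (c * x) = (Real.sqrt d : ℂ) * ψ (d * (c * x)) := h2
  have h4 : dilationMap c hc (dilationMap d hd ψ) x =
    (Real.sqrt c : ℂ) * dilationMap d hd ψ (c * x) := h1
  rw [h4, h3, ← mul_assoc, ← mul_assoc, mul_comm d c, hcd, one_mul, ← Complex.ofReal_mul,
    ← Real.sqrt_mul hc.le, hcd]
  simp

/-- The unitary dilation `(V_c ψ)(x) = c^{1/2} ψ(c x)`, for `c > 0`. -/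
def dilation (c : ℝ) (hc : 0 < c) : L2 ≃ₗᵢ[ℂ] L2 where
  toLinearEquiv := LinearEquiv.ofLinearMap (dilationMap c hc) (dilationMap c⁻¹ (inv_pos.2 hc))
    (LinearMap.ext fun ψ => dilationMap_dilationMap hc (inv_pos.2 hc) (mul_inv_cancel₀ hc.ne') ψ)
    (LinearMap.ext fun ψ => dilationMap_dilationMap (inv_pos.2 hc) hc (inv_mul_cancel₀ hc.ne') ψ)
  norm_map' ψ := by
    change ‖(memLp_dilation hc ψ).toLp‖ = ‖ψ‖
    rw [Lp.norm_toLp, Lp.norm_def, eLpNorm_dilation hc]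

theorem dilation_apply {c : ℝ} (hc : 0 < c) (ψ : L2) :
    ∀ᵐ x : ℝ, dilation c hc ψ x = (Real.sqrt c : ℂ) * ψ (c * x) :=
  (memLp_dilation hc ψ).coeFn_toLp

/-- The unitary Fourier transform `(ℱu)(ξ) = (2π)^{-1/2} ∫ e^{-ixξ} u(x) dx` of `L²(ℝ)`.
Mathlib's `L²` Fourier transform extends `ξ ↦ ∫ e^{-2πixξ} u(x) dx`, so it is followed here by
the unitary dilation with factor `1/(2π)`. -/
def unitaryFourier : L2 ≃ₗᵢ[ℂ] L2 :=
  (Lp.fourierTransformₗᵢ ℝ ℂ).trans (dilation (2 * Real.pi)⁻¹ (by positivity))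

theorem unitaryFourier_apply (u : 𝓢(ℝ, ℂ)) :
    ∀ᵐ ξ : ℝ, unitaryFourier (u.toLp 2) ξ =
      ((1 / Real.sqrt (2 * Real.pi) : ℝ) : ℂ) *
        ∫ x : ℝ, Complex.exp (-(Complex.I * x * ξ)) * u x := by
  have hpos : 0 < (2 * Real.pi)⁻¹ := by positivity
  have h0 : Lp.fourierTransformₗᵢ ℝ ℂ (u.toLp 2) = (𝓕 u).toLp 2 := SchwartzMap.toLp_fourier_eq u
  have h1 := dilation_apply hpos (Lp.fourierTransformₗᵢ ℝ ℂ (u.toLp 2))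
  rw [h0] at h1
  filter_upwards [h1, ae_comp_mul hpos (SchwartzMap.coeFn_toLp (𝓕 u) 2 volume)] with ξ h2 h3
  have h4 : unitaryFourier (u.toLp 2) ξ = dilation (2 * Real.pi)⁻¹ hpos ((𝓕 u).toLp 2) ξ := by
    rw [← h0]; rfl
  rw [h4, h2, h3, Real.sqrt_inv, one_div, SchwartzMap.fourier_coe, Real.fourier_eq]
  congr 1
  refine integral_congr_ae (Filter.Eventually.of_forall fun x => ?_)
  simp only [Circle.smul_def, Real.fourierChar_apply, smul_eq_mul, RCLike.inner_apply, conj_trivial]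
  congr 2
  push_cast
  have hpi : (Real.pi : ℂ) ≠ 0 := by exact_mod_cast Real.pi_ne_zero
  field_simp

/-- `U₁`: multiplication by `e^{-iδx²/2}`. -/
def U₁ (δ : ℝ) : L2 ≃ₗᵢ[ℂ] L2 := phase (fun x => -(δ * x ^ 2 / 2)) (by fun_prop)

/-- `U₂ = ℱ⁻¹ e^{-iξ²/(4δ)} ℱ`. -/
def U₂ (δ : ℝ) : L2 ≃ₗᵢ[ℂ] L2 :=
  unitaryFourier.trans
    ((phase (fun ξ => -(ξ ^ 2 / (4 * δ))) (by fun_prop)).trans unitaryFourier.symm)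

/-- `U₃`: the dilation `(U₃ψ)(x) = (2δ)^{1/4} ψ((2δ)^{1/2} x)`. -/
def U₃ (δ : ℝ) (hδ : 0 < δ) : L2 ≃ₗᵢ[ℂ] L2 :=
  dilation (Real.sqrt (2 * δ)) (Real.sqrt_pos.2 (by positivity))

/-- `U = U₁ U₂ U₃` (so `U₃` acts first). -/
def swansonUnitary (δ : ℝ) (hδ : 0 < δ) : L2 ≃ₗᵢ[ℂ] L2 :=
  (U₃ δ hδ).trans ((U₂ δ).trans (U₁ δ))

/-- `δ = (ω+α+β)^{1/2} (ω-α-β)^{-1/2}`. -/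
def delta (ω α β : ℝ) : ℝ := Real.sqrt (ω + α + β) / Real.sqrt (ω - α - β)

theorem delta_pos {ω α β : ℝ} (h : 0 < ω - |α + β|) : 0 < delta ω α β := by
  have h1 := le_abs_self (α + β)
  have h2 := neg_abs_le (α + β)
  exact div_pos (Real.sqrt_pos.2 (by linarith)) (Real.sqrt_pos.2 (by linarith))

/-- `ζ = √(ω² - (α+β)²) + i(α-β)`. -/
def zeta (ω α β : ℝ) : ℂ := (Real.sqrt (ω ^ 2 - (α + β) ^ 2) : ℂ) + Complex.I * ((α - β : ℝ) : ℂ)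

end

end Swanson

open Swanson

namespace Swanson

/-! ### Weak derivatives and multiplication by `x` through test functions -/

/-! Every operator here comes from a form that is quadratic in the pair `(ψ', xψ)`, and every factor
of `U` acts on that pair by a constant complex 2×2 matrix (`IsMetaplectic`): a quadratic phase
shears `d/dx` by a multiple of `x`, a dilation is diagonal, the Fourier transform exchanges the two
up to factors. Hence conjugating by `U` amounts to substituting its matrix into the four
coefficients of a `quadForm`.

Since `U` and `U⁻¹` both act in this way, they preserve the form domain `Dom(a)`, and the relation
`t(φ, ψ) = ⟪φ, η⟫` that defines the operator graph is carried over exactly. This gives equality of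
operators with their domains, with no regularity result for the operator domain
(`unitaryConj_quadForm_operator`).

Write `A = ω-α-β`, `B = ω+α+β`, so that `Aδ = B/δ = √(AB)`. The matrix of `U` kills the mixed terms
because of this balance, turns `A‖ψ'‖² + B‖xψ‖²` into `√(AB)(‖ψ'‖² + ‖xψ‖²)`, and sends the skew
part, of coefficient `α-β`, to `i(α-β)(‖ψ'‖² - ‖xψ‖²)`. The new coefficients are `ζ` and `ζ̄`
(`unitaryConj_swanson`).

Analytically, `c₄ = -c̄₃` makes the mixed terms imaginary on the diagonal, so `Re t[ψ]` controls
`‖ψ'‖² + ‖xψ‖²` as soon as `Re c₁, Re c₂ > 0`. Sectoriality follows at once, closedness follows from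
the closed graphs of `d/dx` and `x`, and surjectivity of `H - z` is Lax–Milgram on the space of
triples `(ψ, ψ', xψ)`. The extension statements are integrations by parts, with the commutation
relation supplying the constant `ω`. -/

theorem integrable_schwartz_mul (φ : 𝓢(ℝ, ℂ)) (ψ : L2) : Integrable fun x => φ x * ψ x :=
  (φ.memLp 2).integrable_mul (Lp.memLp ψ)

theorem temperedDistribution_ext_iff {f g : 𝓢'(ℝ, ℂ)} : f = g ↔ ∀ φ : 𝓢(ℝ, ℂ), f φ = g φ := by
  refine ⟨?_, fun h => ?_⟩
  · rintro rfl φ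
    rfl
  · ext φ
    exact h φ

theorem mem_derivGraph_iff {ψ η : L2} :
    (ψ, η) ∈ derivGraph ↔
      ∀ φ : 𝓢(ℝ, ℂ), ∫ x, deriv φ x * ψ x = -∫ x, φ x * η x := by
  change TemperedDistribution.derivCLM ℂ (Lp.toTemperedDistributionCLM ℂ volume 2 ψ) =
    Lp.toTemperedDistributionCLM ℂ volume 2 η ↔ _
  rw [temperedDistribution_ext_iff]
  refine forall_congr' fun φ => ?_
  rw [TemperedDistribution.derivCLM_apply_apply, map_neg,
    Lp.toTemperedDistributionCLM_apply, Lp.toTemperedDistributionCLM_apply,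
    Lp.toTemperedDistribution_apply, Lp.toTemperedDistribution_apply, neg_eq_iff_eq_neg]
  simp [SchwartzMap.derivCLM_apply]

theorem hasTemperateGrowth_coe : (fun x : ℝ => (x : ℂ)).HasTemperateGrowth :=
  Function.Complex.hasTemperateGrowth_ofReal

theorem smulLeftCLM_coe_apply (ψ : L2) (φ : 𝓢(ℝ, ℂ)) :
    TemperedDistribution.smulLeftCLM ℂ (fun x : ℝ => (x : ℂ))
      (Lp.toTemperedDistributionCLM ℂ volume 2 ψ) φ = ∫ x : ℝ, φ x * ((x : ℂ) * ψ x) := by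
  rw [TemperedDistribution.smulLeftCLM_apply_apply, Lp.toTemperedDistributionCLM_apply,
    Lp.toTemperedDistribution_apply]
  refine integral_congr_ae (Filter.Eventually.of_forall fun x => ?_)
  simp only [SchwartzMap.smulLeftCLM_apply_apply hasTemperateGrowth_coe, smul_eq_mul]
  ring

/-- In this form multiplication by `x` is continuous on tempered distributions, which yields
closedness of the graph and compatibility with the Fourier transform. -/
theorem mem_positionGraph_iff {ψ η : L2} :
    (ψ, η) ∈ positionGraph ↔
      TemperedDistribution.smulLeftCLM ℂ (fun x : ℝ => (x : ℂ))
        (Lp.toTemperedDistributionCLM ℂ volume 2 ψ) =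
      Lp.toTemperedDistributionCLM ℂ volume 2 η := by
  constructor
  · intro h
    have h' : ∀ᵐ x : ℝ, η x = (x : ℂ) * ψ x := h
    refine temperedDistribution_ext_iff.2 fun φ => ?_
    rw [smulLeftCLM_coe_apply, Lp.toTemperedDistributionCLM_apply,
      Lp.toTemperedDistribution_apply]
    refine integral_congr_ae ?_
    filter_upwards [h'] with x hx
    rw [hx, smul_eq_mul]
  · intro h
    change ∀ᵐ x : ℝ, η x = (x : ℂ) * ψ x
    -- `xψ` is not known to be in `L²` in advance; local integrability is enough to test against
    -- compactly supported smooth functions.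
    have hψ : LocallyIntegrable ψ volume := (Lp.memLp ψ).locallyIntegrable one_le_two
    have hη : LocallyIntegrable η volume := (Lp.memLp η).locallyIntegrable one_le_two
    have hxψ : LocallyIntegrable (fun x : ℝ => (x : ℂ) * ψ x) volume := by
      rw [← locallyIntegrableOn_univ] at hψ ⊢
      exact hψ.continuousOn_mul (by fun_prop) isOpen_univ.isLocallyClosed
    refine ae_eq_of_integral_contDiff_smul_eq hη hxψ fun g hg hc => ?_
    have hg₁ : HasCompactSupport (Complex.ofRealCLM ∘ g) := hc.comp_left rfl
    have hg₂ : ContDiff ℝ (⊤ : ℕ∞) (Complex.ofRealCLM ∘ g) := by fun_prop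
    have := temperedDistribution_ext_iff.1 h (hg₁.toSchwartzMap hg₂)
    rw [smulLeftCLM_coe_apply, Lp.toTemperedDistributionCLM_apply,
      Lp.toTemperedDistribution_apply] at this
    simpa using this.symm

theorem isClosed_derivGraph : IsClosed (derivGraph : Set (L2 × L2)) := by
  refine isClosed_eq (f := fun p : L2 × L2 => TemperedDistribution.derivCLM ℂ
    (Lp.toTemperedDistributionCLM ℂ volume 2 p.1))
    (g := fun p => Lp.toTemperedDistributionCLM ℂ volume 2 p.2) ?_ ?_ <;> fun_prop

theorem isClosed_positionGraph : IsClosed (positionGraph : Set (L2 × L2)) := by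
  have : (positionGraph : Set (L2 × L2)) = {p | TemperedDistribution.smulLeftCLM ℂ
      (fun x : ℝ => (x : ℂ)) (Lp.toTemperedDistributionCLM ℂ volume 2 p.1) =
      Lp.toTemperedDistributionCLM ℂ volume 2 p.2} :=
    Set.ext fun p => mem_positionGraph_iff (ψ := p.1) (η := p.2)
  rw [this]
  refine isClosed_eq ?_ ?_ <;> fun_prop

/-- The Leibniz rule for the product of a weakly differentiable function and a smooth function
of temperate growth. -/
theorem mem_derivGraph_mul {ψ η χ χ' : L2} {g g' : ℝ → ℂ} (hg : g.HasTemperateGrowth)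
    (hg' : ∀ x, HasDerivAt g (g' x) x) (h : (ψ, η) ∈ derivGraph)
    (hχ : ∀ᵐ x, χ x = g x * ψ x) (hχ' : ∀ᵐ x, χ' x = g' x * ψ x + g x * η x) :
    (χ, χ') ∈ derivGraph := by
  rw [mem_derivGraph_iff] at h ⊢
  intro φ
  have hφ : ∀ x, SchwartzMap.smulLeftCLM ℂ g φ x = g x * φ x := fun x => by
    rw [SchwartzMap.smulLeftCLM_apply_apply hg, smul_eq_mul]
  have hd : ∀ x, deriv (SchwartzMap.smulLeftCLM ℂ g φ) x = g' x * φ x + g x * deriv φ x := by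
    intro x
    have : (SchwartzMap.smulLeftCLM ℂ g φ : ℝ → ℂ) = fun x => g x * φ x := funext hφ
    rw [this]
    exact ((hg' x).mul φ.differentiableAt.hasDerivAt).deriv
  -- Temperate growth makes `gφ` a Schwartz function, so the weak derivative of `ψ` may be tested
  -- against it.
  have h1 := h (SchwartzMap.smulLeftCLM ℂ g φ)
  have i1 := integrable_schwartz_mul (SchwartzMap.derivCLM ℂ ℂ (SchwartzMap.smulLeftCLM ℂ g φ)) ψ
  simp only [SchwartzMap.derivCLM_apply] at i1
  have i2 := integrable_schwartz_mul (SchwartzMap.smulLeftCLM ℂ g φ) η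
  have i3 := integrable_schwartz_mul φ χ'
  calc ∫ x, deriv φ x * χ x
      = ∫ x, (deriv (SchwartzMap.smulLeftCLM ℂ g φ) x * ψ x - φ x * χ' x
          + SchwartzMap.smulLeftCLM ℂ g φ x * η x) := by
        refine integral_congr_ae ?_
        filter_upwards [hχ, hχ'] with x h2 h3
        rw [h2, h3, hd, hφ]
        ring
    _ = -∫ x, φ x * χ' x := by
        have h4 := integral_add (i1.sub i3) i2
        simp only [Pi.sub_apply] at h4
        rw [h4, integral_sub i1 i3, h1]
        ring

/-! ### Transformations of the pair `(d/dx, x)` -/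

/-- `U` transforms the derivative and the position operator linearly:
`(Uψ)' = U(a ψ' + b xψ)` and `x Uψ = U(c ψ' + d xψ)`. -/
structure IsMetaplectic (U : L2 ≃ₗᵢ[ℂ] L2) (a b c d : ℂ) : Prop where
  deriv_mem : ∀ {ψ η χ : L2}, (ψ, η) ∈ derivGraph → (ψ, χ) ∈ positionGraph →
    (U ψ, U (a • η + b • χ)) ∈ derivGraph
  position_mem : ∀ {ψ η χ : L2}, (ψ, η) ∈ derivGraph → (ψ, χ) ∈ positionGraph →
    (U ψ, U (c • η + d • χ)) ∈ positionGraph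

/-- The matrix of `V ∘ U` is the product of the matrix of `V` with that of `U`, in this order. -/
theorem IsMetaplectic.trans {U V : L2 ≃ₗᵢ[ℂ] L2} {a b c d a' b' c' d' : ℂ}
    (hU : IsMetaplectic U a b c d) (hV : IsMetaplectic V a' b' c' d') :
    IsMetaplectic (U.trans V) (a' * a + b' * c) (a' * b + b' * d)
      (c' * a + d' * c) (c' * b + d' * d) := by
  constructor <;> intro ψ η χ h1 h2
  · have e : U.trans V ((a' * a + b' * c) • η + (a' * b + b' * d) • χ) =
        V (a' • U (a • η + b • χ) + b' • U (c • η + d • χ)) := by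
      simp only [LinearIsometryEquiv.trans_apply, map_add, map_smul]
      module
    rw [e]
    exact hV.deriv_mem (hU.deriv_mem h1 h2) (hU.position_mem h1 h2)
  · have e : U.trans V ((c' * a + d' * c) • η + (c' * b + d' * d) • χ) =
        V (c' • U (a • η + b • χ) + d' • U (c • η + d • χ)) := by
      simp only [LinearIsometryEquiv.trans_apply, map_add, map_smul]
      module
    rw [e]
    exact hV.position_mem (hU.deriv_mem h1 h2) (hU.position_mem h1 h2)

theorem IsMetaplectic.congr {U V : L2 ≃ₗᵢ[ℂ] L2} {a b c d a' b' c' d' : ℂ}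
    (hU : IsMetaplectic U a b c d) (h : ∀ ψ, U ψ = V ψ) (ha : a = a') (hb : b = b')
    (hc : c = c') (hd : d = d') : IsMetaplectic V a' b' c' d' := by
  obtain rfl : U = V := LinearIsometryEquiv.ext h
  subst ha hb hc hd
  exact hU

/-! ### Quadratic phases -/

theorem iteratedDeriv_cexp_I_mul (n : ℕ) :
    iteratedDeriv n (fun t : ℝ => Complex.exp (Complex.I * t)) =
      fun t : ℝ => Complex.I ^ n * Complex.exp (Complex.I * t) := by
  induction n with
  | zero => simp
  | succ n ih =>
    rw [iteratedDeriv_succ, ih]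
    funext t
    have h1 : HasDerivAt (fun t : ℝ => Complex.I * (t : ℂ)) (Complex.I * 1) t :=
      (Complex.ofRealCLM.hasDerivAt (x := t)).const_mul Complex.I
    rw [((h1.cexp).const_mul (Complex.I ^ n)).deriv]
    ring

/-- All derivatives of `e^{it}` have modulus one. Composing with a real quadratic polynomial then
makes a chirp an admissible multiplier in the Leibniz rule. -/
theorem hasTemperateGrowth_cexp_I_mul :
    (fun t : ℝ => Complex.exp (Complex.I * t)).HasTemperateGrowth := by
  refine ⟨?_, fun n => ⟨0, 1, fun t => ?_⟩⟩
  · have : ContDiff ℝ (⊤ : ℕ∞) fun t : ℝ => (t : ℂ) := Complex.ofRealCLM.contDiff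
    exact (contDiff_const.mul this).cexp
  · rw [norm_iteratedFDeriv_eq_norm_iteratedDeriv, iteratedDeriv_cexp_I_mul, norm_mul, norm_pow,
      Complex.norm_I, mul_comm Complex.I, Complex.norm_exp_ofReal_mul_I]
    simp

theorem isMetaplectic_phase {g : ℝ → ℝ} (hg : Measurable g) (s : ℝ) (hs : ∀ x, g x = s * x ^ 2) :
    IsMetaplectic (phase g hg) 1 (2 * s * Complex.I) 0 1 := by
  constructor <;> intro ψ η χ h1 h2
  · have h2' : ∀ᵐ x : ℝ, χ x = (x : ℂ) * ψ x := h2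
    have hd : ∀ x : ℝ, HasDerivAt (fun x : ℝ => Complex.exp (Complex.I * (g x : ℂ)))
        (2 * s * Complex.I * x * Complex.exp (Complex.I * (g x : ℂ))) x := by
      intro x
      have h3 : HasDerivAt g (s * (2 * x)) x := by
        rw [funext hs]
        simpa using (hasDerivAt_pow 2 x).const_mul s
      convert! ((h3.ofReal_comp).const_mul Complex.I).cexp using 1
      push_cast
      ring
    have ht : (fun x : ℝ => Complex.exp (Complex.I * (g x : ℂ))).HasTemperateGrowth := by
      have : g.HasTemperateGrowth := by
        rw [funext hs]
        exact (Function.HasTemperateGrowth.const s).mul (Function.HasTemperateGrowth.id'.pow 2)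
      exact hasTemperateGrowth_cexp_I_mul.comp this
    refine mem_derivGraph_mul ht hd h1 (phase_apply hg ψ) ?_
    filter_upwards [phase_apply hg ((1 : ℂ) • η + (2 * s * Complex.I) • χ), h2',
      Lp.coeFn_add ((1 : ℂ) • η) ((2 * s * Complex.I) • χ), Lp.coeFn_smul (1 : ℂ) η,
      Lp.coeFn_smul (2 * s * Complex.I) χ] with x e1 e2 e3 e4 e5
    rw [e1, e3, Pi.add_apply, e4, e5, Pi.smul_apply, Pi.smul_apply, e2, smul_eq_mul, smul_eq_mul]
    ring
  · have h2' : ∀ᵐ x : ℝ, χ x = (x : ℂ) * ψ x := h2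
    rw [zero_smul, one_smul, zero_add]
    change ∀ᵐ x : ℝ, phase g hg χ x = (x : ℂ) * phase g hg ψ x
    filter_upwards [phase_apply hg ψ, phase_apply hg χ, h2'] with x e1 e2 e3
    rw [e1, e2, e3]
    ring

theorem isMetaplectic_phase_symm {g : ℝ → ℝ} (hg : Measurable g) (s : ℝ)
    (hs : ∀ x, g x = s * x ^ 2) :
    IsMetaplectic (phase g hg).symm 1 (-(2 * s * Complex.I)) 0 1 :=
  (isMetaplectic_phase hg.neg (-s) fun x => by simp [hs]).congr (fun _ => rfl) rfl
    (by push_cast; ring) rfl rfl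

/-! ### Dilations -/

theorem integral_comp_inv_mul {c : ℝ} (hc : 0 < c) (f : ℝ → ℂ) :
    ∫ x : ℝ, f (c⁻¹ * x) = c * ∫ x : ℝ, f x := by
  rw [Measure.integral_comp_mul_left, inv_inv, abs_of_pos hc, Complex.real_smul]

theorem isMetaplectic_dilation {c : ℝ} (hc : 0 < c) :
    IsMetaplectic (dilation c hc) c 0 0 (c⁻¹ : ℝ) := by
  constructor <;> intro ψ η χ h1 h2
  · rw [zero_smul, add_zero]
    rw [mem_derivGraph_iff] at h1 ⊢
    intro φ
    let e : ℝ ≃L[ℝ] ℝ := ContinuousLinearEquiv.unitsEquivAut ℝ (Units.mk0 c⁻¹ (inv_ne_zero hc.ne'))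
    have he : ∀ x, e x = c⁻¹ * x := fun x => by
      simp [e, mul_comm]
    let φ' : 𝓢(ℝ, ℂ) := SchwartzMap.compCLMOfContinuousLinearEquiv ℂ e φ
    have hφ : ∀ x, φ' x = φ (c⁻¹ * x) := fun x => by
      rw [← he]; rfl
    have hφd : ∀ x, deriv φ' x = ((c⁻¹ : ℝ) : ℂ) * deriv φ (c⁻¹ * x) := fun x => by
      rw [show (φ' : ℝ → ℂ) = fun x => φ (c⁻¹ * x) from funext hφ]
      rw [deriv_comp_mul_left, Complex.real_smul]
    have hcc : c * c⁻¹ = 1 := mul_inv_cancel₀ hc.ne'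
    -- A change of variables moves the dilation from the `L²` function to the test function.
    have key : ∀ (f : ℝ → ℂ) (u : L2), ∫ x, f x * dilation c hc u x =
        ((c⁻¹ * Real.sqrt c : ℝ) : ℂ) * ∫ x, f (c⁻¹ * x) * u x := by
      intro f u
      have e1 : ∫ x, f x * dilation c hc u x = ∫ x, f x * ((Real.sqrt c : ℂ) * u (c * x)) := by
        refine integral_congr_ae ?_
        filter_upwards [dilation_apply hc u] with x hx
        rw [hx]
      have e2 := integral_comp_inv_mul hc fun x => f x * ((Real.sqrt c : ℂ) * u (c * x))
      have e3 : ∫ x : ℝ, f (c⁻¹ * x) * ((Real.sqrt c : ℂ) * u (c * (c⁻¹ * x))) =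
          (Real.sqrt c : ℂ) * ∫ x, f (c⁻¹ * x) * u x := by
        rw [← integral_const_mul]
        refine integral_congr_ae (Filter.Eventually.of_forall fun x => ?_)
        simp only
        rw [← mul_assoc c, hcc, one_mul]
        ring
      rw [e3] at e2
      have hc' : (c : ℂ) ≠ 0 := by exact_mod_cast hc.ne'
      rw [e1]
      push_cast
      rw [mul_assoc, e2, inv_mul_cancel_left₀ hc']
    have h3 := h1 φ'
    rw [key (deriv φ) ψ, map_smul]
    have e4 : ∫ x, φ x * ((c : ℂ) • dilation c hc η) x =
        c * ∫ x, φ x * dilation c hc η x := by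
      rw [← integral_const_mul]
      refine integral_congr_ae ?_
      filter_upwards [Lp.coeFn_smul (c : ℂ) (dilation c hc η)] with x hx
      rw [hx, Pi.smul_apply, smul_eq_mul]
      ring
    rw [e4, key φ η]
    simp only [hφ, hφd, mul_assoc] at h3
    rw [integral_const_mul] at h3
    have hc' : (c : ℂ) ≠ 0 := by exact_mod_cast hc.ne'
    have h5 : ∫ x, deriv φ (c⁻¹ * x) * ψ x = -(c * ∫ x, φ (c⁻¹ * x) * η x) := by
      rw [← mul_neg, ← h3, ← mul_assoc, ← Complex.ofReal_mul, hcc]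
      simp
    rw [h5]
    ring
  · have h2' : ∀ᵐ x : ℝ, χ x = (x : ℂ) * ψ x := h2
    rw [zero_smul, zero_add, map_smul]
    change ∀ᵐ x : ℝ, (((c⁻¹ : ℝ) : ℂ) • dilation c hc χ) x = (x : ℂ) * dilation c hc ψ x
    filter_upwards [dilation_apply hc ψ, dilation_apply hc χ, ae_comp_mul hc h2',
      Lp.coeFn_smul ((c⁻¹ : ℝ) : ℂ) (dilation c hc χ)] with x e1 e2 e3 e4
    rw [e4, Pi.smul_apply, e1, e2, e3, smul_eq_mul]
    have hc' : (c : ℂ) ≠ 0 := by exact_mod_cast hc.ne'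
    push_cast
    field_simp

theorem isMetaplectic_dilation_symm {c : ℝ} (hc : 0 < c) :
    IsMetaplectic (dilation c hc).symm (c⁻¹ : ℝ) 0 0 c :=
  (isMetaplectic_dilation (inv_pos.2 hc)).congr (fun _ => rfl) rfl rfl rfl (by rw [inv_inv])

/-! ### Fourier transform -/

open LineDeriv in
theorem derivCLM_eq_lineDerivOp (f : 𝓢'(ℝ, ℂ)) :
    TemperedDistribution.derivCLM ℂ f = ∂_{(1 : ℝ)} f := by
  refine temperedDistribution_ext_iff.2 fun φ => ?_
  rw [TemperedDistribution.derivCLM_apply_apply, TemperedDistribution.lineDerivOp_apply_apply]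
  congr 2

theorem mem_derivGraph_fourier {ψ χ : L2} (h : (ψ, χ) ∈ positionGraph) :
    (Lp.fourierTransformₗᵢ ℝ ℂ ψ, Lp.fourierTransformₗᵢ ℝ ℂ (-(2 * Real.pi * Complex.I) • χ))
      ∈ derivGraph := by
  rw [mem_positionGraph_iff] at h
  change TemperedDistribution.derivCLM ℂ (Lp.toTemperedDistribution (𝓕 ψ)) =
    Lp.toTemperedDistribution (𝓕 (-(2 * Real.pi * Complex.I) • χ))
  rw [derivCLM_eq_lineDerivOp, ← Lp.fourier_toTemperedDistribution_eq,
    ← Lp.fourier_toTemperedDistribution_eq, TemperedDistribution.lineDerivOp_fourier_eq]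
  congr 1
  rw [← Lp.toTemperedDistributionCLM_apply, ← Lp.toTemperedDistributionCLM_apply, map_smul, ← h]
  simp

theorem mem_derivGraph_fourier_symm {ψ χ : L2} (h : (ψ, χ) ∈ positionGraph) :
    ((Lp.fourierTransformₗᵢ ℝ ℂ).symm ψ,
      (Lp.fourierTransformₗᵢ ℝ ℂ).symm ((2 * Real.pi * Complex.I) • χ)) ∈ derivGraph := by
  rw [mem_positionGraph_iff] at h
  change TemperedDistribution.derivCLM ℂ (Lp.toTemperedDistribution (𝓕⁻ ψ)) =
    Lp.toTemperedDistribution (𝓕⁻ ((2 * Real.pi * Complex.I) • χ))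
  rw [derivCLM_eq_lineDerivOp, ← Lp.fourierInv_toTemperedDistribution_eq,
    ← Lp.fourierInv_toTemperedDistribution_eq, TemperedDistribution.lineDerivOp_fourierInv_eq]
  congr 1
  rw [← Lp.toTemperedDistributionCLM_apply, ← Lp.toTemperedDistributionCLM_apply, map_smul, ← h]
  simp

theorem mem_positionGraph_fourier {ψ η : L2} (h : (ψ, η) ∈ derivGraph) :
    (Lp.fourierTransformₗᵢ ℝ ℂ ψ, Lp.fourierTransformₗᵢ ℝ ℂ ((2 * Real.pi * Complex.I)⁻¹ • η))
      ∈ positionGraph := by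
  have h' : TemperedDistribution.derivCLM ℂ (Lp.toTemperedDistribution ψ) =
    Lp.toTemperedDistribution η := h
  rw [mem_positionGraph_iff]
  change TemperedDistribution.smulLeftCLM ℂ (fun x : ℝ => (x : ℂ))
    (Lp.toTemperedDistribution (𝓕 ψ)) =
    Lp.toTemperedDistribution (𝓕 ((2 * Real.pi * Complex.I)⁻¹ • η))
  rw [FourierTransform.fourier_smul, ← Lp.toTemperedDistributionCLM_apply (f := _ • _), map_smul,
    Lp.toTemperedDistributionCLM_apply, ← Lp.fourier_toTemperedDistribution_eq,
    ← Lp.fourier_toTemperedDistribution_eq, ← h', derivCLM_eq_lineDerivOp,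
    TemperedDistribution.fourier_lineDerivOp_eq,
    inv_smul_smul₀ Complex.two_pi_I_ne_zero]
  simp

theorem mem_positionGraph_fourier_symm {ψ η : L2} (h : (ψ, η) ∈ derivGraph) :
    ((Lp.fourierTransformₗᵢ ℝ ℂ).symm ψ,
      (Lp.fourierTransformₗᵢ ℝ ℂ).symm ((-(2 * Real.pi * Complex.I))⁻¹ • η)) ∈ positionGraph := by
  have h' : TemperedDistribution.derivCLM ℂ (Lp.toTemperedDistribution ψ) =
    Lp.toTemperedDistribution η := h
  rw [mem_positionGraph_iff]
  change TemperedDistribution.smulLeftCLM ℂ (fun x : ℝ => (x : ℂ))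
    (Lp.toTemperedDistribution (𝓕⁻ ψ)) =
    Lp.toTemperedDistribution (𝓕⁻ ((-(2 * Real.pi * Complex.I))⁻¹ • η))
  rw [FourierTransform.fourierInv_smul, ← Lp.toTemperedDistributionCLM_apply (f := _ • _),
    map_smul, Lp.toTemperedDistributionCLM_apply, ← Lp.fourierInv_toTemperedDistribution_eq,
    ← Lp.fourierInv_toTemperedDistribution_eq, ← h', derivCLM_eq_lineDerivOp,
    TemperedDistribution.fourierInv_lineDerivOp_eq,
    inv_smul_smul₀ (neg_ne_zero.2 Complex.two_pi_I_ne_zero)]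
  simp

theorem isMetaplectic_fourier :
    IsMetaplectic (Lp.fourierTransformₗᵢ ℝ ℂ) 0 (-(2 * Real.pi * Complex.I))
      (2 * Real.pi * Complex.I)⁻¹ 0 :=
  ⟨fun _ h => by rw [zero_smul, zero_add]; exact mem_derivGraph_fourier h,
    fun h _ => by rw [zero_smul, add_zero]; exact mem_positionGraph_fourier h⟩

theorem isMetaplectic_fourier_symm :
    IsMetaplectic (Lp.fourierTransformₗᵢ ℝ ℂ).symm 0 (2 * Real.pi * Complex.I)
      (-(2 * Real.pi * Complex.I))⁻¹ 0 :=
  ⟨fun _ h => by rw [zero_smul, zero_add]; exact mem_derivGraph_fourier_symm h,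
    fun h _ => by rw [zero_smul, add_zero]; exact mem_positionGraph_fourier_symm h⟩

theorem isMetaplectic_unitaryFourier :
    IsMetaplectic unitaryFourier 0 (-Complex.I) (-Complex.I) 0 := by
  refine (isMetaplectic_fourier.trans (isMetaplectic_dilation (by positivity))).congr
    (fun _ => rfl) (by ring) ?_ ?_ (by ring) <;>
  · have : (Real.pi : ℂ) ≠ 0 := by exact_mod_cast Real.pi_ne_zero
    push_cast
    field_simp
    simp

theorem isMetaplectic_unitaryFourier_symm :
    IsMetaplectic unitaryFourier.symm 0 Complex.I Complex.I 0 := by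
  refine ((isMetaplectic_dilation_symm (by positivity)).trans isMetaplectic_fourier_symm).congr
    (fun _ => rfl) (by ring) ?_ ?_ (by ring) <;>
  · have : (Real.pi : ℂ) ≠ 0 := by exact_mod_cast Real.pi_ne_zero
    push_cast
    field_simp
    try simp

/-! ### The three factors of `U` and their inverses -/

theorem isMetaplectic_U₁ (δ : ℝ) : IsMetaplectic (U₁ δ) 1 (-(δ * Complex.I)) 0 1 :=
  (isMetaplectic_phase _ (-(δ / 2)) fun x => by ring).congr (fun _ => rfl) rfl
    (by push_cast; ring) rfl rfl

theorem isMetaplectic_U₁_symm (δ : ℝ) : IsMetaplectic (U₁ δ).symm 1 (δ * Complex.I) 0 1 :=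
  (isMetaplectic_phase_symm _ (-(δ / 2)) fun x => by ring).congr (fun _ => rfl) rfl
    (by push_cast; ring) rfl rfl

/-- The Fourier transform exchanges `d/dx` and `x`, so the conjugated chirp fixes `d/dx` and shears
`x` by a multiple of `d/dx`. -/
theorem isMetaplectic_U₂ (δ : ℝ) :
    IsMetaplectic (U₂ δ) 1 0 (-(Complex.I / (2 * δ))) 1 := by
  refine (isMetaplectic_unitaryFourier.trans ((isMetaplectic_phase (by fun_prop)
    (-(1 / (4 * δ))) fun x => ?_).trans isMetaplectic_unitaryFourier_symm)).congr (fun _ => rfl)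
    ?_ ?_ ?_ ?_
  · ring
  · ring_nf; simp
  · ring
  · push_cast
    linear_combination (2 * (1 / (4 * (δ : ℂ))) * Complex.I) * Complex.I_mul_I
  · linear_combination -Complex.I_mul_I

theorem isMetaplectic_U₂_symm (δ : ℝ) :
    IsMetaplectic (U₂ δ).symm 1 0 (Complex.I / (2 * δ)) 1 := by
  have h := isMetaplectic_phase_symm (g := fun ξ => -(ξ ^ 2 / (4 * δ))) (by fun_prop)
    (-(1 / (4 * δ))) fun x => by ring
  have e : (U₂ δ).symm = (unitaryFourier.trans (phase (fun ξ => -(ξ ^ 2 / (4 * δ)))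
      (by fun_prop)).symm).trans unitaryFourier.symm := by
    rw [U₂, LinearIsometryEquiv.symm_trans, LinearIsometryEquiv.symm_trans,
      LinearIsometryEquiv.symm_symm]
  refine ((isMetaplectic_unitaryFourier.trans h).trans isMetaplectic_unitaryFourier_symm).congr
    (fun _ => by rw [e]) ?_ ?_ ?_ ?_
  · ring_nf; simp
  · ring
  · push_cast
    linear_combination (-(2 * (1 / (4 * (δ : ℂ))) * Complex.I)) * Complex.I_mul_I
  · linear_combination -Complex.I_mul_I

/-- Conjugation by `U = U₁ U₂ U₃` maps `d/dx` to `(s/2) d/dx - (iδ/s) x` and `x` to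
`-(i s/(2δ)) d/dx + (1/s) x`, where `s = √(2δ)`. -/
theorem isMetaplectic_swansonUnitary {δ : ℝ} (hδ : 0 < δ) :
    IsMetaplectic (swansonUnitary δ hδ) (Real.sqrt (2 * δ) / 2)
      (-(δ * Complex.I / Real.sqrt (2 * δ))) (-(Complex.I * Real.sqrt (2 * δ) / (2 * δ)))
      (1 / Real.sqrt (2 * δ)) := by
  have hδ' : (δ : ℂ) ≠ 0 := by exact_mod_cast hδ.ne'
  have h3 : IsMetaplectic (U₃ δ hδ) (Real.sqrt (2 * δ)) 0 0 ((Real.sqrt (2 * δ))⁻¹ : ℝ) :=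
    isMetaplectic_dilation _
  refine (h3.trans ((isMetaplectic_U₂ δ).trans (isMetaplectic_U₁ δ))).congr (fun _ => rfl)
    ?_ ?_ ?_ ?_
  · field_simp
    linear_combination (Real.sqrt (2 * δ) : ℂ) * Complex.I_sq
  · push_cast
    ring
  · ring
  · push_cast
    ring

/-- The entries are irrelevant: their existence alone shows that `U⁻¹` preserves the form domain. -/
theorem isMetaplectic_swansonUnitary_symm {δ : ℝ} (hδ : 0 < δ) :
    ∃ a b c d : ℂ, IsMetaplectic (swansonUnitary δ hδ).symm a b c d :=
  have h3 : IsMetaplectic (U₃ δ hδ).symm ((Real.sqrt (2 * δ))⁻¹ : ℝ) 0 0 (Real.sqrt (2 * δ)) :=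
    isMetaplectic_dilation_symm _
  ⟨_, _, _, _, ((isMetaplectic_U₁_symm δ).trans (isMetaplectic_U₂_symm δ)).trans h3⟩

/-! ### Symmetry of `x`, skew-symmetry of `d/dx`, and the form domain -/

theorem inner_position_left {φ φ' ψ ψ' : L2} (hφ : (φ, φ') ∈ positionGraph)
    (hψ : (ψ, ψ') ∈ positionGraph) : ⟪φ', ψ⟫_ℂ = ⟪φ, ψ'⟫_ℂ := by
  have h1 : ∀ᵐ x : ℝ, φ' x = (x : ℂ) * φ x := hφ
  have h2 : ∀ᵐ x : ℝ, ψ' x = (x : ℂ) * ψ x := hψ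
  rw [L2.inner_def, L2.inner_def]
  refine integral_congr_ae ?_
  filter_upwards [h1, h2] with x e1 e2
  rw [e1, e2, RCLike.inner_apply, RCLike.inner_apply, map_mul, Complex.conj_ofReal]
  ring

/-- This is the symmetry of multiplication by `x` seen through the Fourier transform; the sign comes
from the purely imaginary factor `(2πi)⁻¹`. No approximation by smooth functions is needed. -/
theorem inner_deriv_left {φ φ' ψ ψ' : L2} (hφ : (φ, φ') ∈ derivGraph)
    (hψ : (ψ, ψ') ∈ derivGraph) : ⟪φ', ψ⟫_ℂ = -⟪φ, ψ'⟫_ℂ := by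
  have h := inner_position_left (mem_positionGraph_fourier hφ) (mem_positionGraph_fourier hψ)
  rw [LinearIsometryEquiv.inner_map_map, LinearIsometryEquiv.inner_map_map, inner_smul_left,
    inner_smul_right] at h
  have hc : (starRingEnd ℂ) (2 * Real.pi * Complex.I)⁻¹ = -(2 * Real.pi * Complex.I)⁻¹ := by
    rw [map_inv₀, map_mul, map_mul, Complex.conj_I, Complex.conj_ofReal, map_ofNat, mul_neg,
      inv_neg]
  rw [hc, neg_mul, ← mul_neg] at h
  have := mul_left_cancel₀ (inv_ne_zero Complex.two_pi_I_ne_zero) h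
  rw [← this, neg_neg]

theorem derivGraph_unique {ψ η η' : L2} (h : (ψ, η) ∈ derivGraph) (h' : (ψ, η') ∈ derivGraph) :
    η = η' := by
  rw [← ddx_graph] at h h'
  exact ddx.mem_graph_snd_inj h h' rfl

theorem positionGraph_unique {ψ η η' : L2} (h : (ψ, η) ∈ positionGraph)
    (h' : (ψ, η') ∈ positionGraph) : η = η' := by
  rw [← position_graph] at h h'
  exact position.mem_graph_snd_inj h h' rfl

theorem mem_formDomain {ψ η χ : L2} (h : (ψ, η) ∈ derivGraph) (h' : (ψ, χ) ∈ positionGraph) :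
    ψ ∈ formDomain := by
  rw [← ddx_graph] at h
  rw [← position_graph] at h'
  exact ⟨ddx.mem_domain_of_mem_graph h, position.mem_domain_of_mem_graph h'⟩

theorem formDeriv_mem (ψ : formDomain) : ((ψ : L2), formDeriv ψ) ∈ derivGraph := by
  rw [← ddx_graph]
  exact ddx.mem_graph ⟨ψ, ψ.2.1⟩

theorem formPosition_mem (ψ : formDomain) : ((ψ : L2), formPosition ψ) ∈ positionGraph := by
  rw [← position_graph]
  exact position.mem_graph ⟨ψ, ψ.2.2⟩

theorem formDeriv_eq {ψ : formDomain} {η : L2} (h : ((ψ : L2), η) ∈ derivGraph) :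
    formDeriv ψ = η :=
  derivGraph_unique (formDeriv_mem ψ) h

theorem formPosition_eq {ψ : formDomain} {η : L2} (h : ((ψ : L2), η) ∈ positionGraph) :
    formPosition ψ = η :=
  positionGraph_unique (formPosition_mem ψ) h

/-! ### Schwartz functions and density of the form domain -/

theorem toLp_mem_derivGraph (φ : 𝓢(ℝ, ℂ)) :
    (φ.toLp 2 volume, (SchwartzMap.derivCLM ℂ ℂ φ).toLp 2 volume) ∈ derivGraph := by
  have h : TemperedDistribution.derivCLM ℂ (Lp.toTemperedDistribution (φ.toLp 2 volume)) =
      Lp.toTemperedDistribution ((SchwartzMap.derivCLM ℂ ℂ φ).toLp 2 volume) := by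
    rw [Lp.toTemperedDistribution_toLp_eq, Lp.toTemperedDistribution_toLp_eq,
      TemperedDistribution.derivCLM_toTemperedDistributionCLM_eq ℂ]
  exact h

theorem toLp_mem_positionGraph (φ : 𝓢(ℝ, ℂ)) :
    (φ.toLp 2 volume, (SchwartzMap.smulLeftCLM ℂ (fun x : ℝ => (x : ℂ)) φ).toLp 2 volume)
      ∈ positionGraph := by
  have h : ∀ᵐ x : ℝ, (SchwartzMap.smulLeftCLM ℂ (fun x : ℝ => (x : ℂ)) φ).toLp 2 volume x =
      (x : ℂ) * φ.toLp 2 volume x := by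
    filter_upwards [SchwartzMap.coeFn_toLp φ 2 volume,
      SchwartzMap.coeFn_toLp (SchwartzMap.smulLeftCLM ℂ (fun x : ℝ => (x : ℂ)) φ) 2 volume]
      with x e1 e2
    rw [e1, e2, SchwartzMap.smulLeftCLM_apply_apply hasTemperateGrowth_coe, smul_eq_mul]
  exact h

theorem dense_formDomain : Dense (formDomain : Set L2) := by
  have h : DenseRange (SchwartzMap.toLpCLM ℝ ℂ 2 (volume : Measure ℝ)) :=
    SchwartzMap.denseRange_toLpCLM ENNReal.ofNat_ne_top
  refine h.mono ?_
  rintro _ ⟨φ, rfl⟩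
  exact mem_formDomain (toLp_mem_derivGraph φ) (toLp_mem_positionGraph φ)

/-! ### Quadratic forms in `d/dx` and `x` -/

noncomputable section

/-- The form `c₁⟪φ', ψ'⟫ + c₂⟪xφ, xψ⟫ + c₃⟪xφ, ψ'⟫ + c₄⟪φ', xψ⟫` on `Dom(a)`. -/
def quadForm (c₁ c₂ c₃ c₄ : ℂ) : SesqForm L2 where
  domain := formDomain
  toFun := c₁ • innerForm formDeriv formDeriv + c₂ • innerForm formPosition formPosition
    + c₃ • innerForm formPosition formDeriv + c₄ • innerForm formDeriv formPosition

theorem quadForm_apply (c₁ c₂ c₃ c₄ : ℂ) (φ ψ : formDomain) :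
    (quadForm c₁ c₂ c₃ c₄).toFun φ ψ = c₁ * ⟪formDeriv φ, formDeriv ψ⟫_ℂ
      + c₂ * ⟪formPosition φ, formPosition ψ⟫_ℂ + c₃ * ⟪formPosition φ, formDeriv ψ⟫_ℂ
      + c₄ * ⟪formDeriv φ, formPosition ψ⟫_ℂ := rfl

theorem swansonForm_eq_quadForm (ω α β : ℝ) :
    swansonForm ω α β = quadForm ((ω - α - β : ℝ) : ℂ) ((ω + α + β : ℝ) : ℂ)
      ((α - β : ℝ) : ℂ) (-((α - β : ℝ) : ℂ)) := by
  refine congrArg (SesqForm.mk formDomain) ?_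
  refine LinearMap.ext₂ fun φ ψ => ?_
  change ((ω - α - β : ℝ) : ℂ) * ⟪formDeriv φ, formDeriv ψ⟫_ℂ
      + ((ω + α + β : ℝ) : ℂ) * ⟪formPosition φ, formPosition ψ⟫_ℂ
      + ((α - β : ℝ) : ℂ) * (⟪formPosition φ, formDeriv ψ⟫_ℂ - ⟪formDeriv φ, formPosition ψ⟫_ℂ)
    = ((ω - α - β : ℝ) : ℂ) * ⟪formDeriv φ, formDeriv ψ⟫_ℂ
      + ((ω + α + β : ℝ) : ℂ) * ⟪formPosition φ, formPosition ψ⟫_ℂ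
      + ((α - β : ℝ) : ℂ) * ⟪formPosition φ, formDeriv ψ⟫_ℂ
      + -((α - β : ℝ) : ℂ) * ⟪formDeriv φ, formPosition ψ⟫_ℂ
  ring

theorem oscillatorForm_eq_quadForm (c₁ c₂ : ℂ) : oscillatorForm c₁ c₂ = quadForm c₁ c₂ 0 0 := by
  refine congrArg (SesqForm.mk formDomain) ?_
  rw [zero_smul, zero_smul, add_zero, add_zero]

/-- Replaces subtypes and `formDeriv`, `formPosition` by membership in the two graphs, the language
in which `IsMetaplectic` is stated. -/
theorem mem_operatorGraph_quadForm {c₁ c₂ c₃ c₄ : ℂ} {ψ η : L2} :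
    (ψ, η) ∈ (quadForm c₁ c₂ c₃ c₄).operatorGraph ↔
      ∃ ψ₁ ψ₂, (ψ, ψ₁) ∈ derivGraph ∧ (ψ, ψ₂) ∈ positionGraph ∧
        ∀ φ φ₁ φ₂, (φ, φ₁) ∈ derivGraph → (φ, φ₂) ∈ positionGraph →
          c₁ * ⟪φ₁, ψ₁⟫_ℂ + c₂ * ⟪φ₂, ψ₂⟫_ℂ + c₃ * ⟪φ₂, ψ₁⟫_ℂ + c₄ * ⟪φ₁, ψ₂⟫_ℂ = ⟪φ, η⟫_ℂ := by
  constructor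
  · rintro ⟨h, h'⟩
    refine ⟨formDeriv ⟨ψ, h⟩, formPosition ⟨ψ, h⟩, formDeriv_mem ⟨ψ, h⟩, formPosition_mem ⟨ψ, h⟩,
      fun φ φ₁ φ₂ h1 h2 => ?_⟩
    have hφ : φ ∈ formDomain := mem_formDomain h1 h2
    obtain rfl := formDeriv_eq (ψ := ⟨φ, hφ⟩) h1
    obtain rfl := formPosition_eq (ψ := ⟨φ, hφ⟩) h2
    exact h' ⟨φ, hφ⟩
  · rintro ⟨ψ₁, ψ₂, h1, h2, h3⟩
    have hψ : ψ ∈ formDomain := mem_formDomain h1 h2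
    obtain rfl := formDeriv_eq (ψ := ⟨ψ, hψ⟩) h1
    obtain rfl := formPosition_eq (ψ := ⟨ψ, hψ⟩) h2
    exact ⟨hψ, fun φ => h3 φ _ _ (formDeriv_mem φ) (formPosition_mem φ)⟩

theorem operator_quadForm_graph (c₁ c₂ c₃ c₄ : ℂ) :
    (quadForm c₁ c₂ c₃ c₄).operator.graph = (quadForm c₁ c₂ c₃ c₄).operatorGraph :=
  SesqForm.operator_graph _ dense_formDomain

/-! ### Sectoriality and closedness -/

theorem quadForm_norm_le (c₁ c₂ c₃ c₄ : ℂ) (ψ : formDomain) :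
    ‖(quadForm c₁ c₂ c₃ c₄).toFun ψ ψ‖ ≤
      (‖c₁‖ + ‖c₂‖ + ‖c₃‖ + ‖c₄‖) * (‖formDeriv ψ‖ ^ 2 + ‖formPosition ψ‖ ^ 2) := by
  rw [quadForm_apply]
  set d := formDeriv ψ
  set p := formPosition ψ
  have key : ∀ (c : ℂ) (u v : L2), ‖u‖ * ‖v‖ ≤ ‖d‖ ^ 2 + ‖p‖ ^ 2 →
      ‖c * ⟪u, v⟫_ℂ‖ ≤ ‖c‖ * (‖d‖ ^ 2 + ‖p‖ ^ 2) := fun c u v h => by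
    rw [norm_mul]
    exact mul_le_mul_of_nonneg_left ((norm_inner_le_norm u v).trans h) (norm_nonneg c)
  have h1 := key c₁ d d (by nlinarith [sq_nonneg ‖p‖])
  have h2 := key c₂ p p (by nlinarith [sq_nonneg ‖d‖])
  have h3 := key c₃ p d (by nlinarith [sq_nonneg (‖d‖ - ‖p‖), sq_nonneg ‖p‖, sq_nonneg ‖d‖])
  have h4 := key c₄ d p (by nlinarith [sq_nonneg (‖d‖ - ‖p‖), sq_nonneg ‖p‖, sq_nonneg ‖d‖])
  refine ((norm_add_le _ _).trans (add_le_add_left ((norm_add_le _ _).trans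
    (add_le_add_left (norm_add_le _ _) _)) _)).trans ?_
  linarith

theorem re_mul_inner_self (c : ℂ) (u : L2) : (c * ⟪u, u⟫_ℂ).re = c.re * ‖u‖ ^ 2 := by
  have h : ⟪u, u⟫_ℂ = ((‖u‖ ^ 2 : ℝ) : ℂ) := by
    rw [inner_self_eq_norm_sq_to_K]
    push_cast
    rfl
  rw [h, Complex.re_mul_ofReal]

theorem re_mul_inner_add_neg (c : ℂ) (u v : L2) :
    (c * ⟪u, v⟫_ℂ + -(starRingEnd ℂ) c * ⟪v, u⟫_ℂ).re = 0 := by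
  rw [← inner_conj_symm v u]
  generalize ⟪u, v⟫_ℂ = w
  simp

/-- On the diagonal the mixed terms are `c₃w - c̄₃w̄` with `w = ⟪xψ, ψ'⟫`, which is purely
imaginary. -/
theorem re_quadForm {c₁ c₂ c₃ c₄ : ℂ} (h : c₄ = -(starRingEnd ℂ) c₃) (ψ : formDomain) :
    ((quadForm c₁ c₂ c₃ c₄).toFun ψ ψ).re =
      c₁.re * ‖formDeriv ψ‖ ^ 2 + c₂.re * ‖formPosition ψ‖ ^ 2 := by
  rw [quadForm_apply, h, add_assoc, Complex.add_re, Complex.add_re, re_mul_inner_self,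
    re_mul_inner_self, re_mul_inner_add_neg, add_zero]

theorem min_mul_add_le (a b u v : ℝ) : min a b * (u ^ 2 + v ^ 2) ≤ a * u ^ 2 + b * v ^ 2 := by
  nlinarith [mul_le_mul_of_nonneg_right (min_le_left a b) (sq_nonneg u),
    mul_le_mul_of_nonneg_right (min_le_right a b) (sq_nonneg v)]

section Elliptic

variable {c₁ c₂ c₃ c₄ : ℂ} (h₁ : 0 < c₁.re) (h₂ : 0 < c₂.re) (h₃ : c₄ = -(starRingEnd ℂ) c₃)
include h₁ h₂ h₃

theorem exists_abs_im_quadForm_le :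
    ∃ k : ℝ, ∀ ψ : formDomain, |((quadForm c₁ c₂ c₃ c₄).toFun ψ ψ).im| ≤
      k * ((quadForm c₁ c₂ c₃ c₄).toFun ψ ψ).re := by
  have hm : 0 < min c₁.re c₂.re := lt_min h₁ h₂
  -- Ratio of the upper bound for `|t[ψ]|` to the lower bound for `Re t[ψ]`, both relative to `‖ψ'‖²
  -- + ‖xψ‖²`.
  refine ⟨(‖c₁‖ + ‖c₂‖ + ‖c₃‖ + ‖c₄‖) / min c₁.re c₂.re, fun ψ => ?_⟩
  refine (Complex.abs_im_le_norm _).trans ((quadForm_norm_le c₁ c₂ c₃ c₄ ψ).trans ?_)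
  rw [re_quadForm h₃, div_mul_eq_mul_div, le_div_iff₀ hm, mul_assoc, mul_comm _ (min _ _)]
  exact mul_le_mul_of_nonneg_left (min_mul_add_le _ _ _ _) (by positivity)

theorem re_quadForm_nonneg (ψ : formDomain) : 0 ≤ ((quadForm c₁ c₂ c₃ c₄).toFun ψ ψ).re := by
  rw [re_quadForm h₃]
  positivity

theorem isSectorial_quadForm : (quadForm c₁ c₂ c₃ c₄).IsSectorial := by
  obtain ⟨k, hk⟩ := exists_abs_im_quadForm_le h₁ h₂ h₃
  refine ⟨0, k, fun ψ => ⟨?_, ?_⟩⟩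
  · rw [zero_mul]
    exact re_quadForm_nonneg h₁ h₂ h₃ ψ
  · rw [zero_mul, sub_zero]
    exact hk ψ

theorem tendsto_norm_of_tendsto_quadForm {ι : Type*} {l : Filter ι} {u : ι → formDomain}
    (h : Filter.Tendsto (fun i => (quadForm c₁ c₂ c₃ c₄).toFun (u i) (u i)) l (nhds 0)) :
    Filter.Tendsto (fun i => ‖formDeriv (u i)‖) l (nhds 0) ∧
      Filter.Tendsto (fun i => ‖formPosition (u i)‖) l (nhds 0) := by
  have hre : Filter.Tendsto (fun i => ((quadForm c₁ c₂ c₃ c₄).toFun (u i) (u i)).re) l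
      (nhds 0) := by
    have h' := (Complex.continuous_re.tendsto 0).comp h
    rw [Complex.zero_re] at h'
    exact h'
  have key : ∀ (c : ℝ) (f : ι → ℝ), 0 < c → (∀ i, 0 ≤ f i) →
      (∀ i, c * f i ^ 2 ≤ ((quadForm c₁ c₂ c₃ c₄).toFun (u i) (u i)).re) →
      Filter.Tendsto f l (nhds 0) := by
    intro c f hc hf hle
    have h1 : Filter.Tendsto (fun i => f i ^ 2) l (nhds 0) := by
      refine squeeze_zero (fun i => sq_nonneg _) (fun i => (le_div_iff₀' hc).2 (hle i)) ?_
      simpa using hre.div_const c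
    have h2 := (Real.continuous_sqrt.tendsto 0).comp h1
    rw [Real.sqrt_zero] at h2
    exact h2.congr fun i => Real.sqrt_sq (hf i)
  refine ⟨key c₁.re _ h₁ (fun i => norm_nonneg _) fun i => ?_,
    key c₂.re _ h₂ (fun i => norm_nonneg _) fun i => ?_⟩ <;>
  · rw [re_quadForm h₃]
    simp only [le_add_iff_nonneg_right, le_add_iff_nonneg_left]
    positivity

/-- A sequence that is Cauchy for `t` has `ψₙ'` and `xψₙ` Cauchy in `L²`. Closedness of the two
graphs identifies their limits, and the upper bound on the form gives convergence in `t`. -/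
theorem isClosed_quadForm : (quadForm c₁ c₂ c₃ c₄).IsClosed := by
  intro u ψ hu ht
  change ℕ → formDomain at u
  obtain ⟨hd, hp⟩ := tendsto_norm_of_tendsto_quadForm h₁ h₂ h₃ (u := fun p : ℕ × ℕ => u p.1 - u p.2) ht
  have hd' : CauchySeq fun n => formDeriv (u n) := by
    rw [cauchySeq_iff_tendsto_dist_atTop_0]
    exact hd.congr fun p => by rw [map_sub, dist_eq_norm]
  have hp' : CauchySeq fun n => formPosition (u n) := by
    rw [cauchySeq_iff_tendsto_dist_atTop_0]
    exact hp.congr fun p => by rw [map_sub, dist_eq_norm]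
  obtain ⟨η, hη⟩ := cauchySeq_tendsto_of_complete hd'
  obtain ⟨χ, hχ⟩ := cauchySeq_tendsto_of_complete hp'
  have e1 : (ψ, η) ∈ derivGraph := isClosed_derivGraph.mem_of_tendsto (hu.prodMk_nhds hη)
    (Filter.Eventually.of_forall fun n => formDeriv_mem (u n))
  have e2 : (ψ, χ) ∈ positionGraph := isClosed_positionGraph.mem_of_tendsto (hu.prodMk_nhds hχ)
    (Filter.Eventually.of_forall fun n => formPosition_mem (u n))
  refine ⟨mem_formDomain e1 e2, ?_⟩
  have f1 : formDeriv ⟨ψ, mem_formDomain e1 e2⟩ = η := formDeriv_eq e1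
  have f2 : formPosition ⟨ψ, mem_formDomain e1 e2⟩ = χ := formPosition_eq e2
  have g1 : Filter.Tendsto (fun n => ‖formDeriv (u n - ⟨ψ, mem_formDomain e1 e2⟩)‖)
      Filter.atTop (nhds 0) := by
    simp only [map_sub, f1]
    exact tendsto_iff_norm_sub_tendsto_zero.1 hη
  have g2 : Filter.Tendsto (fun n => ‖formPosition (u n - ⟨ψ, mem_formDomain e1 e2⟩)‖)
      Filter.atTop (nhds 0) := by
    simp only [map_sub, f2]
    exact tendsto_iff_norm_sub_tendsto_zero.1 hχ
  refine squeeze_zero_norm (fun n => quadForm_norm_le c₁ c₂ c₃ c₄ _) ?_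
  have g3 := ((g1.pow 2).add (g2.pow 2)).const_mul (‖c₁‖ + ‖c₂‖ + ‖c₃‖ + ‖c₄‖)
  rw [zero_pow two_ne_zero, add_zero, mul_zero] at g3
  exact g3

end Elliptic

/-! ### The first representation theorem -/

/-- The form domain with its graph norm, as a closed subspace of `L² ⊕ L² ⊕ L²`: the triples
`(ψ, ψ', xψ)`. -/
def formSpace : Submodule ℂ (PiLp 2 fun _ : Fin 3 => L2) :=
  derivGraph.comap ((PiLp.proj (𝕜 := ℂ) 2 (fun _ : Fin 3 => L2) 0).prod
      (PiLp.proj 2 (fun _ : Fin 3 => L2) 1)).toLinearMap ⊓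
    positionGraph.comap ((PiLp.proj (𝕜 := ℂ) 2 (fun _ : Fin 3 => L2) 0).prod
      (PiLp.proj 2 (fun _ : Fin 3 => L2) 2)).toLinearMap

instance completeSpace_formSpace : CompleteSpace formSpace :=
  have h : IsClosed (formSpace : Set (PiLp 2 fun _ : Fin 3 => L2)) :=
    (isClosed_derivGraph.preimage (ContinuousLinearMap.continuous _)).inter
      (isClosed_positionGraph.preimage (ContinuousLinearMap.continuous _))
  h.completeSpace_coe

/-- The component maps of `formSpace`. -/
def formSpaceProj (i : Fin 3) : formSpace →L[ℂ] L2 :=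
  PiLp.proj 2 (fun _ : Fin 3 => L2) i ∘L formSpace.subtypeL

theorem formSpace_norm_sq (w : formSpace) :
    ‖w‖ ^ 2 = ‖formSpaceProj 0 w‖ ^ 2 + ‖formSpaceProj 1 w‖ ^ 2 + ‖formSpaceProj 2 w‖ ^ 2 := by
  have := PiLp.norm_sq_eq_of_L2 (fun _ : Fin 3 => L2) (w : PiLp 2 fun _ : Fin 3 => L2)
  rw [Fin.sum_univ_three] at this
  exact this

section Elliptic

variable {c₁ c₂ c₃ c₄ : ℂ} (h₁ : 0 < c₁.re) (h₂ : 0 < c₂.re) (h₃ : c₄ = -(starRingEnd ℂ) c₃)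
include h₁ h₂ h₃

/-- Lax–Milgram: `S` represents the form `t - z` on the Hilbert space of triples, and it is coercive
because `-Re z`, `Re c₁` and `Re c₂` are positive, hence invertible. -/
theorem exists_mem_operatorGraph_quadForm {z : ℂ} (hz : z.re < 0) (η : L2) :
    ∃ ψ, (ψ, η + z • ψ) ∈ (quadForm c₁ c₂ c₃ c₄).operatorGraph := by
  let P := formSpaceProj
  let S : formSpace →L[ℂ] formSpace := (-z) • ((P 0).adjoint ∘L P 0)
    + c₁ • ((P 1).adjoint ∘L P 1) + c₂ • ((P 2).adjoint ∘L P 2)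
    + c₃ • ((P 2).adjoint ∘L P 1) + c₄ • ((P 1).adjoint ∘L P 2)
  have hS : ∀ v w, ⟪v, S w⟫_ℂ = -z * ⟪P 0 v, P 0 w⟫_ℂ + c₁ * ⟪P 1 v, P 1 w⟫_ℂ
      + c₂ * ⟪P 2 v, P 2 w⟫_ℂ + c₃ * ⟪P 2 v, P 1 w⟫_ℂ + c₄ * ⟪P 1 v, P 2 w⟫_ℂ := by
    intro v w
    have key : ∀ (c : ℂ) (i j : Fin 3),
        ⟪v, (c • ((P i).adjoint ∘L P j)) w⟫_ℂ = c * ⟪P i v, P j w⟫_ℂ := fun c i j =>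
      (inner_smul_right _ _ _).trans
        (congrArg (c * ·) (ContinuousLinearMap.adjoint_inner_right (P i) v (P j w)))
    simp only [S, add_apply, inner_add_right, key]
  let m : ℝ := min (-z.re) (min c₁.re c₂.re)
  have hm : 0 < m := lt_min (by linarith) (lt_min h₁ h₂)
  have hco : ∀ w, ‖w‖ ^ 2 * m ≤ (⟪w, S w⟫_ℂ).re := by
    intro w
    rw [hS, h₃, add_assoc, Complex.add_re, Complex.add_re, Complex.add_re, re_mul_inner_self,
      re_mul_inner_self, re_mul_inner_self, re_mul_inner_add_neg, formSpace_norm_sq, Complex.neg_re]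
    have m0 : m ≤ -z.re := min_le_left _ _
    have m1 : m ≤ c₁.re := (min_le_right _ _).trans (min_le_left _ _)
    have m2 : m ≤ c₂.re := (min_le_right _ _).trans (min_le_right _ _)
    have k0 := mul_le_mul_of_nonneg_right m0 (sq_nonneg ‖P 0 w‖)
    have k1 := mul_le_mul_of_nonneg_right m1 (sq_nonneg ‖P 1 w‖)
    have k2 := mul_le_mul_of_nonneg_right m2 (sq_nonneg ‖P 2 w‖)
    change (‖P 0 w‖ ^ 2 + ‖P 1 w‖ ^ 2 + ‖P 2 w‖ ^ 2) * m ≤ _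
    linarith
  have hunit : IsUnit S := by
    refine ContinuousLinearMap.isUnit_of_forall_le_norm_inner_map S (c := ⟨m, hm.le⟩) hm
      fun w => ?_
    rw [norm_inner_symm]
    exact (hco w).trans (Complex.re_le_norm _)
  -- The vector `(P 0)* η` represents the functional `φ ↦ ⟪φ, η⟫` on triples.
  obtain ⟨w, hw⟩ : ∃ w, S w = (P 0).adjoint η := by
    obtain ⟨T, hT⟩ := hunit.exists_right_inv
    exact ⟨T ((P 0).adjoint η), by
      rw [← mul_apply_eq_comp, hT, one_apply_eq_self]⟩
  refine ⟨P 0 w, mem_operatorGraph_quadForm.2 ⟨P 1 w, P 2 w, w.2.1, w.2.2,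
    fun φ φ₁ φ₂ hφ₁ hφ₂ => ?_⟩⟩
  let v : formSpace := ⟨WithLp.toLp 2 ![φ, φ₁, φ₂], hφ₁, hφ₂⟩
  have h := hS v w
  rw [hw, ContinuousLinearMap.adjoint_inner_right] at h
  have h' : ⟪φ, η⟫_ℂ = -z * ⟪φ, P 0 w⟫_ℂ + c₁ * ⟪φ₁, P 1 w⟫_ℂ
      + c₂ * ⟪φ₂, P 2 w⟫_ℂ + c₃ * ⟪φ₂, P 1 w⟫_ℂ + c₄ * ⟪φ₁, P 2 w⟫_ℂ := h
  rw [inner_add_right, inner_smul_right, h']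
  ring

theorem isMSectorial_quadForm_operator : IsMSectorial (quadForm c₁ c₂ c₃ c₄).operator := by
  obtain ⟨k, hk⟩ := exists_abs_im_quadForm_le h₁ h₂ h₃
  set t := quadForm c₁ c₂ c₃ c₄ with ht
  have hgraph : t.operator.graph = t.operatorGraph := operator_quadForm_graph _ _ _ _
  have hval : ∀ ψ : t.operator.domain, ∃ h : (ψ : L2) ∈ formDomain,
      ⟪(ψ : L2), t.operator ψ⟫_ℂ = t.toFun ⟨ψ, h⟩ ⟨ψ, h⟩ := by
    intro ψ
    have := t.operator.mem_graph ψ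
    rw [hgraph] at this
    obtain ⟨h, h'⟩ := this
    exact ⟨h, (h' ⟨ψ, h⟩).symm⟩
  have hsurj : ∀ z : ℂ, z.re < 0 →
      Function.Surjective fun ψ : t.operator.domain => t.operator ψ - z • (ψ : L2) := by
    intro z hz η
    obtain ⟨ψ, hψ⟩ := exists_mem_operatorGraph_quadForm h₁ h₂ h₃ hz η
    rw [← ht, ← hgraph, LinearPMap.mem_graph_iff] at hψ
    obtain ⟨y, hy, hy'⟩ := hψ
    exact ⟨y, by simp only [hy', hy, add_sub_cancel_right]⟩
  refine ⟨?_, 0, k, fun ψ => ?_, hsurj⟩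
  -- If `f` is orthogonal to the domain, write `f = (H + 1)ψ`; pairing with `ψ` gives `Re t[ψ] +
  -- ‖ψ‖² = 0`, so `ψ = 0` and `f = 0`.
  · rw [Submodule.dense_iff_topologicalClosure_eq_top,
      Submodule.topologicalClosure_eq_top_iff, Submodule.eq_bot_iff]
    intro f hf
    obtain ⟨ψ, hψ⟩ := hsurj (-1) (by simp) f
    obtain ⟨hd, hv⟩ := hval ψ
    have h0 : ⟪(ψ : L2), f⟫_ℂ = 0 := hf ψ ψ.2
    simp only [neg_smul, one_smul, sub_neg_eq_add] at hψ
    rw [← hψ, inner_add_right, hv] at h0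
    have h1 := congrArg Complex.re h0
    have h2 : 0 ≤ (t.toFun ⟨ψ, hd⟩ ⟨ψ, hd⟩).re := re_quadForm_nonneg h₁ h₂ h₃ ⟨ψ, hd⟩
    have h3 := re_mul_inner_self 1 (ψ : L2)
    rw [one_mul, Complex.one_re, one_mul] at h3
    rw [Complex.add_re, h3, Complex.zero_re] at h1
    have h4 : ‖(ψ : L2)‖ ^ 2 = 0 := le_antisymm (by linarith) (sq_nonneg _)
    have h5 : ψ = 0 := Subtype.ext (norm_eq_zero.1 (pow_eq_zero_iff two_ne_zero |>.1 h4))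
    rw [← hψ, h5, LinearPMap.map_zero]
    simp
  · obtain ⟨hd, hv⟩ := hval ψ
    rw [hv, zero_mul, sub_zero]
    exact ⟨re_quadForm_nonneg h₁ h₂ h₃ _, hk _⟩

end Elliptic

end

/-! ### Graphs of sums, products and conjugates -/

section Graph

variable {E : Type*} [NormedAddCommGroup E] [InnerProductSpace ℂ E]

theorem exists_of_mem_graph_add {S T : E →ₗ.[ℂ] E} {ψ η : E} (h : (ψ, η) ∈ (S + T).graph) :
    ∃ η₁ η₂, (ψ, η₁) ∈ S.graph ∧ (ψ, η₂) ∈ T.graph ∧ η = η₁ + η₂ := by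
  obtain ⟨y, rfl, rfl⟩ := (LinearPMap.mem_graph_iff _).1 h
  exact ⟨_, _, S.mem_graph ⟨y, y.2.1⟩, T.mem_graph ⟨y, y.2.2⟩, LinearPMap.add_apply S T y⟩

theorem exists_of_mem_graph_smul {T : E →ₗ.[ℂ] E} {c : ℂ} {ψ η : E} (h : (ψ, η) ∈ (c • T).graph) :
    ∃ η₁, (ψ, η₁) ∈ T.graph ∧ η = c • η₁ := by
  obtain ⟨y, rfl, rfl⟩ := (LinearPMap.mem_graph_iff _).1 h
  exact ⟨_, T.mem_graph y, LinearPMap.smul_apply c T y⟩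

theorem mem_graph_smul {T : E →ₗ.[ℂ] E} (c : ℂ) {ψ η : E} (h : (ψ, η) ∈ T.graph) :
    (ψ, c • η) ∈ (c • T).graph := by
  obtain ⟨y, rfl, rfl⟩ := (LinearPMap.mem_graph_iff _).1 h
  exact (c • T).mem_graph y

theorem exists_of_mem_graph_neg {T : E →ₗ.[ℂ] E} {ψ η : E} (h : (ψ, η) ∈ (-T).graph) :
    ∃ η₁, (ψ, η₁) ∈ T.graph ∧ η = -η₁ := by
  obtain ⟨y, rfl, rfl⟩ := (LinearPMap.mem_graph_iff _).1 h
  exact ⟨_, T.mem_graph y, LinearPMap.neg_apply T y⟩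

theorem exists_of_mem_graph_opComp {S T : E →ₗ.[ℂ] E} {ψ η : E}
    (h : (ψ, η) ∈ (opComp S T).graph) : ∃ χ, (ψ, χ) ∈ T.graph ∧ (χ, η) ∈ S.graph := by
  obtain ⟨⟨_, y, hy, rfl⟩, rfl, rfl⟩ := (LinearPMap.mem_graph_iff _).1 h
  exact ⟨T y, T.mem_graph y, S.mem_graph ⟨T y, hy⟩⟩

theorem eq_of_mem_graph_opId {ψ η : E} (h : (ψ, η) ∈ (opId : E →ₗ.[ℂ] E).graph) : η = ψ := by
  obtain ⟨y, rfl, rfl⟩ := (LinearPMap.mem_graph_iff _).1 h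
  rfl

theorem mem_graph_unitaryConj {U : E ≃ₗᵢ[ℂ] E} {T : E →ₗ.[ℂ] E} {ψ η : E} :
    (ψ, η) ∈ (unitaryConj U T).graph ↔ (U ψ, U η) ∈ T.graph := by
  constructor
  · intro h
    obtain ⟨y, rfl, rfl⟩ := (LinearPMap.mem_graph_iff _).1 h
    have : U (unitaryConj U T y) = T ⟨U y, y.2⟩ := U.apply_symm_apply _
    rw [this]
    exact T.mem_graph ⟨U y, y.2⟩
  · intro h
    obtain ⟨y, hy, hy'⟩ := (LinearPMap.mem_graph_iff _).1 h
    have hψ : U ψ ∈ T.domain := T.mem_domain_of_mem_graph h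
    refine (LinearPMap.mem_graph_iff _).2 ⟨⟨ψ, hψ⟩, rfl, ?_⟩
    change U.symm (T ⟨U ψ, hψ⟩) = η
    have : (⟨U ψ, hψ⟩ : T.domain) = y := Subtype.ext hy.symm
    rw [this, hy']
    exact U.symm_apply_apply η

end Graph

theorem exists_of_mem_graph_annihilation {ψ η : L2} (h : (ψ, η) ∈ annihilation.graph) :
    ∃ ψ₁ ψ₂, (ψ, ψ₁) ∈ derivGraph ∧ (ψ, ψ₂) ∈ positionGraph ∧ η = ψ₁ + ψ₂ := by
  rw [← ddx_graph, ← position_graph]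
  exact exists_of_mem_graph_add h

theorem exists_of_mem_graph_creation {ψ η : L2} (h : (ψ, η) ∈ creation.graph) :
    ∃ ψ₁ ψ₂, (ψ, ψ₁) ∈ derivGraph ∧ (ψ, ψ₂) ∈ positionGraph ∧ η = -ψ₁ + ψ₂ := by
  rw [← ddx_graph, ← position_graph]
  obtain ⟨_, ψ₂, h1, h2, rfl⟩ := exists_of_mem_graph_add h
  obtain ⟨ψ₁, h3, rfl⟩ := exists_of_mem_graph_neg h1
  exact ⟨ψ₁, ψ₂, h3, h2, rfl⟩

/-! ### The operators associated with quadratic forms -/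

/-- The case `c = 0` is excluded because `0 • H` keeps the domain of `H`, whereas the operator of
the zero form is defined on the whole form domain. -/
theorem smul_quadForm_operator {c : ℂ} (hc : c ≠ 0) (c₁ c₂ c₃ c₄ : ℂ) :
    c • (quadForm c₁ c₂ c₃ c₄).operator =
      (quadForm (c * c₁) (c * c₂) (c * c₃) (c * c₄)).operator := by
  refine LinearPMap.eq_of_eq_graph (Submodule.ext ?_)
  rintro ⟨ψ, η⟩
  rw [operator_quadForm_graph, mem_operatorGraph_quadForm]
  constructor
  · intro h
    obtain ⟨η, h', rfl⟩ := exists_of_mem_graph_smul h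
    rw [operator_quadForm_graph, mem_operatorGraph_quadForm] at h'
    obtain ⟨ψ₁, ψ₂, h1, h2, h3⟩ := h'
    refine ⟨ψ₁, ψ₂, h1, h2, fun φ φ₁ φ₂ k1 k2 => ?_⟩
    rw [inner_smul_right, ← h3 φ φ₁ φ₂ k1 k2]
    ring
  · rintro ⟨ψ₁, ψ₂, h1, h2, h3⟩
    rw [← smul_inv_smul₀ hc η]
    refine mem_graph_smul c ?_
    rw [operator_quadForm_graph, mem_operatorGraph_quadForm]
    refine ⟨ψ₁, ψ₂, h1, h2, fun φ φ₁ φ₂ k1 k2 => ?_⟩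
    rw [inner_smul_right, ← h3 φ φ₁ φ₂ k1 k2]
    field_simp

/-- The four hypotheses say that the coefficient matrix is transformed as `M* C M`, where `M` is the
matrix of `U`. The entries for `U⁻¹` serve only to pull functions back into the form domain. -/
theorem unitaryConj_quadForm_operator {U : L2 ≃ₗᵢ[ℂ] L2} {a b c d a' b' c' d' : ℂ}
    (hU : IsMetaplectic U a b c d) (hU' : IsMetaplectic U.symm a' b' c' d')
    {c₁ c₂ c₃ c₄ e₁ e₂ e₃ e₄ : ℂ}
    (h₁ : c₁ * (star a * a) + c₂ * (star c * c) + c₃ * (star c * a) + c₄ * (star a * c) = e₁)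
    (h₂ : c₁ * (star b * b) + c₂ * (star d * d) + c₃ * (star d * b) + c₄ * (star b * d) = e₂)
    (h₃ : c₁ * (star b * a) + c₂ * (star d * c) + c₃ * (star d * a) + c₄ * (star b * c) = e₃)
    (h₄ : c₁ * (star a * b) + c₂ * (star c * d) + c₃ * (star c * b) + c₄ * (star a * d) = e₄) :
    unitaryConj U (quadForm c₁ c₂ c₃ c₄).operator = (quadForm e₁ e₂ e₃ e₄).operator := by
  have key : ∀ φ₁ φ₂ ψ₁ ψ₂ : L2,
      c₁ * ⟪U (a • φ₁ + b • φ₂), U (a • ψ₁ + b • ψ₂)⟫_ℂ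
        + c₂ * ⟪U (c • φ₁ + d • φ₂), U (c • ψ₁ + d • ψ₂)⟫_ℂ
        + c₃ * ⟪U (c • φ₁ + d • φ₂), U (a • ψ₁ + b • ψ₂)⟫_ℂ
        + c₄ * ⟪U (a • φ₁ + b • φ₂), U (c • ψ₁ + d • ψ₂)⟫_ℂ
      = e₁ * ⟪φ₁, ψ₁⟫_ℂ + e₂ * ⟪φ₂, ψ₂⟫_ℂ + e₃ * ⟪φ₂, ψ₁⟫_ℂ + e₄ * ⟪φ₁, ψ₂⟫_ℂ := by
    intro φ₁ φ₂ ψ₁ ψ₂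
    simp only [LinearIsometryEquiv.inner_map_map, inner_add_left, inner_add_right,
      inner_smul_left, inner_smul_right, ← h₁, ← h₂, ← h₃, ← h₄, starRingEnd_apply]
    ring
  refine LinearPMap.eq_of_eq_graph (Submodule.ext ?_)
  rintro ⟨ψ, η⟩
  rw [mem_graph_unitaryConj, operator_quadForm_graph, operator_quadForm_graph,
    mem_operatorGraph_quadForm, mem_operatorGraph_quadForm]
  constructor
  · rintro ⟨χ₁, χ₂, h1, h2, h3⟩
    have k1 := hU'.deriv_mem h1 h2
    have k2 := hU'.position_mem h1 h2
    rw [LinearIsometryEquiv.symm_apply_apply] at k1 k2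
    refine ⟨_, _, k1, k2, fun φ φ₁ φ₂ l1 l2 => ?_⟩
    -- Uniqueness of `χ'` and `xχ` for `χ = Uψ` identifies `χ₁`, `χ₂` with the images under `U` that
    -- occur in `key`.
    rw [← key, ← derivGraph_unique h1 (hU.deriv_mem k1 k2),
      ← positionGraph_unique h2 (hU.position_mem k1 k2),
      h3 _ _ _ (hU.deriv_mem l1 l2) (hU.position_mem l1 l2), LinearIsometryEquiv.inner_map_map]
  · rintro ⟨ψ₁, ψ₂, h1, h2, h3⟩
    refine ⟨_, _, hU.deriv_mem h1 h2, hU.position_mem h1 h2, fun χ χ₁ χ₂ l1 l2 => ?_⟩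
    -- An arbitrary test function `χ` is written as `U(U⁻¹χ)`, so the relation for `ψ` is applied to
    -- `U⁻¹χ`.
    have k1 := hU'.deriv_mem l1 l2
    have k2 := hU'.position_mem l1 l2
    have m1 := hU.deriv_mem k1 k2
    have m2 := hU.position_mem k1 k2
    rw [LinearIsometryEquiv.apply_symm_apply] at m1 m2
    have h4 := h3 _ _ _ k1 k2
    rwa [← key, ← derivGraph_unique l1 m1, ← positionGraph_unique l2 m2,
      ← LinearIsometryEquiv.inner_map_map U (U.symm χ) η, LinearIsometryEquiv.apply_symm_apply] at h4

/-- The canonical commutation relation `(xψ)' = ψ + xψ'`. -/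
theorem mem_derivGraph_position {ψ ψ₁ ψ₂ χ : L2} (h₁ : (ψ, ψ₁) ∈ derivGraph)
    (h₂ : (ψ, ψ₂) ∈ positionGraph) (h : (ψ₁, χ) ∈ positionGraph) : (ψ₂, ψ + χ) ∈ derivGraph := by
  have h2' : ∀ᵐ x : ℝ, ψ₂ x = (x : ℂ) * ψ x := h₂
  have h' : ∀ᵐ x : ℝ, χ x = (x : ℂ) * ψ₁ x := h
  refine mem_derivGraph_mul (g' := fun _ => 1) hasTemperateGrowth_coe
    (fun x => Complex.ofRealCLM.hasDerivAt (x := x)) h₁ h2' ?_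
  filter_upwards [Lp.coeFn_add ψ χ, h'] with x e1 e2
  rw [e1, Pi.add_apply, e2, one_mul]

/-- Scalar multiples keep their domains, even for a zero scalar, so `ψ` lies in the domains of
`a*a`, `a²` and `(a*)²` at once, and each product can be integrated by parts separately. -/
theorem ladderExpression_le_swanson (ω α β : ℝ) : ladderExpression ω α β ≤ swanson ω α β := by
  refine LinearPMap.le_of_le_graph ?_
  rintro ⟨ψ, η⟩ hη
  rw [swanson, swansonForm_eq_quadForm, operator_quadForm_graph, mem_operatorGraph_quadForm]
  obtain ⟨σ, _, h, h₀, rfl⟩ := exists_of_mem_graph_add hη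
  obtain ⟨τ, _, h', h₃, rfl⟩ := exists_of_mem_graph_add h
  obtain ⟨_, _, h₁, h₂, rfl⟩ := exists_of_mem_graph_add h'
  obtain ⟨_, k₀, rfl⟩ := exists_of_mem_graph_smul h₀
  obtain rfl := eq_of_mem_graph_opId k₀
  obtain ⟨η₁, k₁, rfl⟩ := exists_of_mem_graph_smul h₁
  obtain ⟨η₂, k₂, rfl⟩ := exists_of_mem_graph_smul h₂
  obtain ⟨η₃, k₃, rfl⟩ := exists_of_mem_graph_smul h₃
  obtain ⟨χ, a₁, m₁⟩ := exists_of_mem_graph_opComp k₁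
  obtain ⟨χ₀, a₂, m₂⟩ := exists_of_mem_graph_opComp k₂
  obtain rfl := annihilation.mem_graph_snd_inj a₁ a₂ rfl
  obtain ⟨χ', a₃, m₃⟩ := exists_of_mem_graph_opComp k₃
  obtain ⟨ψ₁, ψ₂, d, p, hχ⟩ := exists_of_mem_graph_annihilation a₁
  obtain ⟨ψ₁', ψ₂', d', p', hχ'⟩ := exists_of_mem_graph_creation a₃
  obtain rfl := derivGraph_unique d d'
  obtain rfl := positionGraph_unique p p'
  obtain ⟨χ₁, χ₂, dχ, pχ, rfl⟩ := exists_of_mem_graph_creation m₁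
  obtain ⟨χ₁', χ₂', dχ', pχ', rfl⟩ := exists_of_mem_graph_annihilation m₂
  obtain rfl := derivGraph_unique dχ dχ'
  obtain rfl := positionGraph_unique pχ pχ'
  obtain ⟨ξ₁, ξ₂, dξ, pξ, rfl⟩ := exists_of_mem_graph_creation m₃
  refine ⟨ψ₁, ψ₂, d, p, fun φ φ₁ φ₂ k1 k2 => ?_⟩
  -- Since `ψ' = (aψ - a*ψ)/2` and both `aψ` and `a*ψ` lie in the domain of `x`, so does `ψ'`. This
  -- is what the commutation relation `(xψ)' = ψ + xψ'` requires.
  have q : (ψ₁, (2⁻¹ : ℂ) • (χ₂ - ξ₂)) ∈ positionGraph := by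
    have := positionGraph.smul_mem (2⁻¹ : ℂ) (positionGraph.sub_mem pχ pξ)
    have e : ψ₁ = (2⁻¹ : ℂ) • (χ - χ') := by
      rw [hχ, hχ']
      module
    rw [e]
    exact this
  have s1 := inner_deriv_left k1 (mem_derivGraph_position d p q)
  have s2 := inner_position_left k2 q
  have s3 := inner_deriv_left k1 dχ
  have s4 := inner_position_left k2 pχ
  have s5 := inner_deriv_left k1 dξ
  have s6 := inner_position_left k2 pξ
  rw [inner_add_right] at s1
  rw [hχ, inner_add_right] at s3 s4
  rw [hχ', inner_add_right, inner_neg_right] at s5 s6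
  simp only [inner_add_right, inner_smul_right, inner_neg_right]
  push_cast
  -- The sum `s1 + s2` reads `⟪φ', xψ⟫ + ⟪xφ, ψ'⟫ = -⟪φ, ψ⟫`; it trades the mixed terms of `ω a*a`
  -- for the additive constant `ω`.
  linear_combination (ω : ℂ) * (s3 + s4) - (ω : ℂ) * (s1 + s2) + (α : ℂ) * (s4 - s3)
    + (β : ℂ) * (s5 + s6)

theorem oscillatorExpression_le (c₂ : ℂ) :
    -opComp ddx ddx + c₂ • opComp position position ≤ (quadForm 1 c₂ 0 0).operator := by
  refine LinearPMap.le_of_le_graph ?_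
  rintro ⟨ψ, η⟩ h
  rw [operator_quadForm_graph, mem_operatorGraph_quadForm]
  obtain ⟨_, _, h1, h2, rfl⟩ := exists_of_mem_graph_add h
  obtain ⟨η₁, k1, rfl⟩ := exists_of_mem_graph_neg h1
  obtain ⟨η₂, k2, rfl⟩ := exists_of_mem_graph_smul h2
  obtain ⟨ψ₁, d, l1⟩ := exists_of_mem_graph_opComp k1
  obtain ⟨ψ₂, p, l2⟩ := exists_of_mem_graph_opComp k2
  rw [ddx_graph] at d l1
  rw [position_graph] at p l2
  refine ⟨ψ₁, ψ₂, d, p, fun φ φ₁ φ₂ k1 k2 => ?_⟩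
  rw [inner_deriv_left k1 l1, inner_position_left k2 l2, inner_add_right, inner_neg_right,
    inner_smul_right]
  ring

theorem smul_le_smul_operator (c : ℂ) {S T : L2 →ₗ.[ℂ] L2} (h : S ≤ T) : c • S ≤ c • T := by
  refine LinearPMap.le_of_le_graph ?_
  rintro ⟨ψ, η⟩ hη
  obtain ⟨η', hη', rfl⟩ := exists_of_mem_graph_smul hη
  exact mem_graph_smul c (LinearPMap.le_graph_of_le h hη')

/-! ### Swanson's operator -/

theorem zeta_re (ω α β : ℝ) : (zeta ω α β).re = Real.sqrt (ω ^ 2 - (α + β) ^ 2) := by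
  simp [zeta]

theorem zeta_re_pos {ω α β : ℝ} (h : 0 < ω - |α + β|) : 0 < (zeta ω α β).re := by
  rw [zeta_re]
  refine Real.sqrt_pos.2 ?_
  have h1 := le_abs_self (α + β)
  have h2 := neg_abs_le (α + β)
  nlinarith

/-- The balance `Aδ = √(AB) = B/δ` for `A = ω-α-β`, `B = ω+α+β`, which makes the mixed terms cancel.
-/
theorem swanson_delta_mul {ω α β : ℝ} (h : 0 < ω - |α + β|) :
    (ω - α - β) * delta ω α β = Real.sqrt (ω ^ 2 - (α + β) ^ 2) ∧
      Real.sqrt (ω ^ 2 - (α + β) ^ 2) * delta ω α β = ω + α + β := by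
  have h1 := le_abs_self (α + β)
  have h2 := neg_abs_le (α + β)
  have hA : 0 < ω - α - β := by linarith
  have hB : 0 < ω + α + β := by linarith
  have hr : Real.sqrt (ω ^ 2 - (α + β) ^ 2) = Real.sqrt (ω - α - β) * Real.sqrt (ω + α + β) := by
    rw [← Real.sqrt_mul hA.le]
    congr 1
    ring
  have sA := Real.mul_self_sqrt hA.le
  have sB := Real.mul_self_sqrt hB.le
  have pA := Real.sqrt_pos.2 hA
  rw [hr, delta]
  constructor
  · nth_rewrite 1 [← sA]
    field_simp
  · nth_rewrite 3 [← sB]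
    field_simp

theorem unitaryConj_swanson {ω α β : ℝ} (h : 0 < ω - |α + β|) :
    unitaryConj (swansonUnitary (delta ω α β) (delta_pos h)) (swanson ω α β) =
      (quadForm (zeta ω α β) ((starRingEnd ℂ) (zeta ω α β)) 0 0).operator := by
  obtain ⟨a', b', c', d', hU'⟩ := isMetaplectic_swansonUnitary_symm (delta_pos h)
  have hδ : (delta ω α β : ℂ) ≠ 0 := by exact_mod_cast (delta_pos h).ne'
  have hs : (Real.sqrt (2 * delta ω α β) : ℂ) ≠ 0 := by
    exact_mod_cast (Real.sqrt_pos.2 (mul_pos two_pos (delta_pos h))).ne'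
  have hs2 : (Real.sqrt (2 * delta ω α β) : ℂ) ^ 2 = 2 * delta ω α β := by
    exact_mod_cast Real.sq_sqrt (mul_pos two_pos (delta_pos h)).le
  obtain ⟨hA, hB⟩ := swanson_delta_mul h
  have hA' : ((ω - α - β : ℝ) : ℂ) * delta ω α β = Real.sqrt (ω ^ 2 - (α + β) ^ 2) := by
    exact_mod_cast hA
  have hB' : (Real.sqrt (ω ^ 2 - (α + β) ^ 2) : ℂ) * delta ω α β = ((ω + α + β : ℝ) : ℂ) := by
    exact_mod_cast hB
  have hz : (starRingEnd ℂ) (zeta ω α β) =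
      Real.sqrt (ω ^ 2 - (α + β) ^ 2) - Complex.I * ((α - β : ℝ) : ℂ) := by
    rw [zeta, map_add, map_mul, Complex.conj_ofReal, Complex.conj_ofReal, Complex.conj_I]
    ring
  have hI : star Complex.I = -Complex.I := Complex.conj_I
  have hr : ∀ r : ℝ, star (r : ℂ) = r := Complex.conj_ofReal
  have h2 : star (2 : ℂ) = 2 := Complex.conj_ofNat 2
  have hA'' : ((ω - α - β : ℝ) : ℂ) = Real.sqrt (ω ^ 2 - (α + β) ^ 2) / delta ω α β := by
    rw [← hA', mul_div_cancel_right₀ _ hδ]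
  -- Eliminating `A = √(AB)/δ` and `B = √(AB)δ` leaves four rational identities in `δ` and `s =
  -- √(2δ)`, to be checked with `s² = 2δ` and `i² = -1`.
  rw [swanson, swansonForm_eq_quadForm, hz, zeta, ← hB', hA'']
  refine unitaryConj_quadForm_operator (isMetaplectic_swansonUnitary (delta_pos h)) hU'
    ?_ ?_ ?_ ?_ <;> simp only [star_neg, star_div₀, star_mul', star_one, hI, hr, h2] <;> field_simp
  · rw [hs2, Complex.I_sq]
    ring
  · rw [hs2, Complex.I_sq]
    ring
  · linear_combination ((α - β : ℝ) : ℂ) * Complex.I_sq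
  · linear_combination -((α - β : ℝ) : ℂ) * Complex.I_sq

end Swanson

theorem mainTheorem3 (ω α β : ℝ) (h : 0 < ω - |α + β|) :
    -- the form is densely defined, sectorial and closed; its operator `H` is m-sectorial
    -- and extends `ω a*a + α a² + β (a*)² + ω`
    Dense ((swansonForm ω α β).domain : Set L2) ∧
    (swansonForm ω α β).IsSectorial ∧
    (swansonForm ω α β).IsClosed ∧
    IsMSectorial (swanson ω α β) ∧
    ladderExpression ω α β ≤ swanson ω α β ∧
    -- `U* H U = ζ (-d²/dx² + (ζ̄/ζ) x²)`, including the operator domains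
    unitaryConj (swansonUnitary (delta ω α β) (delta_pos h)) (swanson ω α β) =
      zeta ω α β • oscillator 1 ((starRingEnd ℂ) (zeta ω α β) / zeta ω α β) ∧
    zeta ω α β • (-opComp ddx ddx +
        ((starRingEnd ℂ) (zeta ω α β) / zeta ω α β) • opComp position position) ≤
      unitaryConj (swansonUnitary (delta ω α β) (delta_pos h)) (swanson ω α β) ∧
    -- this is a positive multiple of a rotated harmonic oscillator
    |(zeta ω α β).arg| < Real.pi / 2 ∧
    (rotatedForm (-(zeta ω α β).arg)).IsSectorial ∧
    (rotatedForm (-(zeta ω α β).arg)).IsClosed ∧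
    IsMSectorial (rotatedOscillator (-(zeta ω α β).arg)) ∧
    unitaryConj (swansonUnitary (delta ω α β) (delta_pos h)) (swanson ω α β) =
      ((‖zeta ω α β‖ : ℝ) : ℂ) • rotatedOscillator (-(zeta ω α β).arg) := by
  have hζ : 0 < (zeta ω α β).re := zeta_re_pos h
  have hζ0 : zeta ω α β ≠ 0 := fun h0 => by simp [h0] at hζ
  have hn : ((‖zeta ω α β‖ : ℝ) : ℂ) ≠ 0 := by exact_mod_cast norm_ne_zero_iff.2 hζ0
  have hA : 0 < ((ω - α - β : ℝ) : ℂ).re := by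
    rw [Complex.ofReal_re]
    linarith [le_abs_self (α + β)]
  have hB : 0 < ((ω + α + β : ℝ) : ℂ).re := by
    rw [Complex.ofReal_re]
    linarith [neg_abs_le (α + β)]
  have hg : -((α - β : ℝ) : ℂ) = -(starRingEnd ℂ) ((α - β : ℝ) : ℂ) := by
    rw [Complex.conj_ofReal]
  have harg : |(zeta ω α β).arg| < Real.pi / 2 := Complex.abs_arg_lt_pi_div_two_iff.2 (Or.inl hζ)
  have hcos : 0 < Real.cos (zeta ω α β).arg := Real.cos_pos_of_mem_Ioo (abs_lt.1 harg)
  have r₁ : 0 < (Complex.exp (-Complex.I * ((-(zeta ω α β).arg : ℝ) : ℂ))).re := by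
    rw [Complex.exp_re]
    simpa using hcos
  have r₂ : 0 < (Complex.exp (Complex.I * ((-(zeta ω α β).arg : ℝ) : ℂ))).re := by
    rw [Complex.exp_re]
    simpa using hcos
  have h0 : (0 : ℂ) = -(starRingEnd ℂ) 0 := by simp
  have hosc : zeta ω α β • oscillator 1 ((starRingEnd ℂ) (zeta ω α β) / zeta ω α β) =
      (quadForm (zeta ω α β) ((starRingEnd ℂ) (zeta ω α β)) 0 0).operator := by
    rw [oscillator, oscillatorForm_eq_quadForm, smul_quadForm_operator hζ0, mul_one, mul_zero,
      mul_div_cancel₀ _ hζ0]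
  have hrot : ((‖zeta ω α β‖ : ℝ) : ℂ) • rotatedOscillator (-(zeta ω α β).arg) =
      (quadForm (zeta ω α β) ((starRingEnd ℂ) (zeta ω α β)) 0 0).operator := by
    -- With `θ = -arg ζ`, the polar form gives `|ζ|e^{-iθ} = ζ` and `|ζ|e^{iθ} = ζ̄`, so the rotated
    -- oscillator leads to the same quadratic form.
    have e₁ : ((‖zeta ω α β‖ : ℝ) : ℂ) * Complex.exp (-Complex.I * ((-(zeta ω α β).arg : ℝ) : ℂ)) =
        zeta ω α β := by
      rw [Complex.ofReal_neg, neg_mul_neg, mul_comm Complex.I]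
      exact Complex.norm_mul_exp_arg_mul_I _
    have e₂ : ((‖zeta ω α β‖ : ℝ) : ℂ) * Complex.exp (Complex.I * ((-(zeta ω α β).arg : ℝ) : ℂ)) =
        (starRingEnd ℂ) (zeta ω α β) := by
      conv_rhs => rw [← e₁]
      rw [map_mul, Complex.conj_ofReal, ← Complex.exp_conj, map_mul, map_neg, Complex.conj_I,
        Complex.conj_ofReal, neg_neg]
    rw [rotatedOscillator, rotatedForm, oscillatorForm_eq_quadForm, smul_quadForm_operator hn,
      mul_zero, e₁, e₂]
  refine ⟨dense_formDomain, ?_, ?_, ?_, ladderExpression_le_swanson ω α β, ?_, ?_, harg, ?_, ?_,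
    ?_, ?_⟩
  · rw [swansonForm_eq_quadForm]
    exact isSectorial_quadForm hA hB hg
  · rw [swansonForm_eq_quadForm]
    exact isClosed_quadForm hA hB hg
  · rw [swanson, swansonForm_eq_quadForm]
    exact isMSectorial_quadForm_operator hA hB hg
  · rw [unitaryConj_swanson h, hosc]
  · rw [unitaryConj_swanson h, ← hosc, oscillator, oscillatorForm_eq_quadForm]
    exact smul_le_smul_operator _ (oscillatorExpression_le _)
  · rw [rotatedForm, oscillatorForm_eq_quadForm]
    exact isSectorial_quadForm r₁ r₂ h0
  · rw [rotatedForm, oscillatorForm_eq_quadForm]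
    exact isClosed_quadForm r₁ r₂ h0
  · rw [rotatedOscillator, rotatedForm, oscillatorForm_eq_quadForm]
    exact isMSectorial_quadForm_operator r₁ r₂ h0
  · rw [unitaryConj_swanson h, hrot]
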